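/- Let $n\ge 0$, let $M^n$ be a connected smooth manifold without boundary (Hausdorff, second countable), and let $x_0:M^n\to\mathbb{R}^{n+1}$ be a proper smooth immersion. Write $II(v,w)$ for the vector-valued second fundamental form of $x_0$ (the normal part of the second derivative) and $\vec H=g^{ij}II_{ij}$ for its trace with respect to the induced metric $g$, i.e. the mean curvature vector. For a smooth unit normal field $\mathbf n$ along $x_0$, put $h=-\langle II,\mathbf n\rangle$ and $H=-\langle\vec H,\mathbf n\rangle=g^{ij}h_{ij}$. Assume that * $x_0$ is a rotator: there is a skew-symmetric matrix $J\in\mathfrak{so}(n+1)$ with $\vec H=(Jx_0)^{\perp}$ on $M$, where $^{\perp}$ denotes the normal part (so that $H=-\langle Jx_0,\mathbf n\rangle$ for every unit normal field $\mathbf n$); * $x_0$ is weakly mean convex: there is a smooth unit normal field $\mathbf n$ along $x_0$ for which $H\ge 0$ on $M$. Then $x_0$ is a minimal hypersurface, i.e. $\vec H\equiv 0$. If, moreover, $x_0$ is weakly convex, i.e. there is a smooth unit normal field along $x_0$ for which $h$ is positive semidefinite at every point, then $x_0$ is a hyperplane, i.e. $x_0$ is an embedding whose image is an affine hyperplane of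 $\mathbb{R}^{n+1}$. -/

import Mathlib

open scoped Manifold ContDiff

noncomputable section

namespace Rotator

/-! ### Immersed hypersurfaces in a local parametrization

`X : ℝⁿ → ℝⁿ⁺¹` is a local parametrization of the hypersurface, smooth near the point `u`. -/

/-- The tangent space of the parametrized hypersurface at `X u`: the span of the `∂ᵢX(u)`. -/
def tangentPlane {n : ℕ} (X : EuclideanSpace ℝ (Fin n) → EuclideanSpace ℝ (Fin (n + 1)))
    (u : EuclideanSpace ℝ (Fin n)) : Submodule ℝ (EuclideanSpace ℝ (Fin (n + 1))) :=
  LinearMap.range (fderiv ℝ X u).toLinearMap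

/-- The normal part `y^⊥` of a vector `y`: its orthogonal projection to the normal space. -/
def normalPart {n : ℕ} (X : EuclideanSpace ℝ (Fin n) → EuclideanSpace ℝ (Fin (n + 1)))
    (u : EuclideanSpace ℝ (Fin n)) (y : EuclideanSpace ℝ (Fin (n + 1))) :
    EuclideanSpace ℝ (Fin (n + 1)) :=
  (tangentPlane X u)ᗮ.starProjection y

/-- The induced metric `g_{ij} = ⟨∂ᵢX, ∂ⱼX⟩`. -/
def metricMatrix {n : ℕ} (X : EuclideanSpace ℝ (Fin n) → EuclideanSpace ℝ (Fin (n + 1)))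
    (u : EuclideanSpace ℝ (Fin n)) : Matrix (Fin n) (Fin n) ℝ :=
  Matrix.of fun i j =>
    inner ℝ (fderiv ℝ X u (EuclideanSpace.single i 1)) (fderiv ℝ X u (EuclideanSpace.single j 1))

/-- The vector-valued second fundamental form: the normal part of the second derivative
`D²X(u)(v, w)`, evaluated on coordinate vectors `v`, `w`. -/
def secondFundamentalForm {n : ℕ}
    (X : EuclideanSpace ℝ (Fin n) → EuclideanSpace ℝ (Fin (n + 1)))
    (u v w : EuclideanSpace ℝ (Fin n)) : EuclideanSpace ℝ (Fin (n + 1)) :=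
  normalPart X u (fderiv ℝ (fderiv ℝ X) u v w)

/-- The mean curvature vector `g^{ij} (∂ᵢ∂ⱼX)^⊥`, the metric trace of the second fundamental
form. -/
def meanCurvatureVector {n : ℕ}
    (X : EuclideanSpace ℝ (Fin n) → EuclideanSpace ℝ (Fin (n + 1)))
    (u : EuclideanSpace ℝ (Fin n)) : EuclideanSpace ℝ (Fin (n + 1)) :=
  ∑ i, ∑ j, (metricMatrix X u)⁻¹ i j •
    secondFundamentalForm X u (EuclideanSpace.single i 1) (EuclideanSpace.single j 1)

/-! ### Immersed hypersurfaces `x : Mⁿ → ℝⁿ⁺¹`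

The quantities above are read in local coordinates: for a chart `e` of `M` the parametrization is
`x ∘ e⁻¹`, and the point `p` has coordinates `e p`. The normal part, the mean curvature vector and
the condition that the second fundamental form be nonnegative do not depend on the chart, so that
each condition below may equivalently be required in all charts of the atlas or in one chart around
each point; it is stated for all charts. -/

section Manifold

variable {n : ℕ} {M : Type*} [TopologicalSpace M] [ChartedSpace (EuclideanSpace ℝ (Fin n)) M]

/-- A proper smooth immersion. -/
structure IsProperImmersion (x : M → EuclideanSpace ℝ (Fin (n + 1))) : Prop where
  smooth : ContMDiff (𝓡 n) 𝓘(ℝ, EuclideanSpace ℝ (Fin (n + 1))) ∞ x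
  immersion : ∀ p : M,
    Function.Injective (mfderiv (𝓡 n) 𝓘(ℝ, EuclideanSpace ℝ (Fin (n + 1))) x p)
  proper : IsProperMap x

/-- A smooth unit normal vector field along the immersion `x`. -/
structure IsUnitNormalField (x ν : M → EuclideanSpace ℝ (Fin (n + 1))) : Prop where
  smooth : ContMDiff (𝓡 n) 𝓘(ℝ, EuclideanSpace ℝ (Fin (n + 1))) ∞ ν
  norm_eq_one : ∀ p : M, ‖ν p‖ = 1
  normal : ∀ e ∈ atlas (EuclideanSpace ℝ (Fin n)) M, ∀ p ∈ e.source,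
    ν p ∈ (tangentPlane (x ∘ e.symm) (e p))ᗮ

/-- `x` is a rotator: its mean curvature vector is `(J x)^⊥` for some `J ∈ 𝔰𝔬(n+1)`. -/
def IsRotator (x : M → EuclideanSpace ℝ (Fin (n + 1))) : Prop :=
  ∃ J ∈ LieAlgebra.Orthogonal.so (Fin (n + 1)) ℝ,
    ∀ e ∈ atlas (EuclideanSpace ℝ (Fin n)) M, ∀ p ∈ e.source,
      meanCurvatureVector (x ∘ e.symm) (e p) =
        normalPart (x ∘ e.symm) (e p) (Matrix.toEuclideanLin J (x p))

/-- `x` is weakly mean convex: for some unit normal field `ν`, the mean curvature `H`, given by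
`H⃗ = -H ν`, is nonnegative everywhere. -/
def IsWeaklyMeanConvex (x : M → EuclideanSpace ℝ (Fin (n + 1))) : Prop :=
  ∃ ν : M → EuclideanSpace ℝ (Fin (n + 1)), IsUnitNormalField x ν ∧
    ∀ e ∈ atlas (EuclideanSpace ℝ (Fin n)) M, ∀ p ∈ e.source,
      0 ≤ -inner ℝ (meanCurvatureVector (x ∘ e.symm) (e p)) (ν p)

/-- `x` is weakly convex: for some unit normal field `ν`, the scalar second fundamental form
`h(v, w) = -⟨II(v, w), ν⟩` is positive semidefinite everywhere. -/
def IsWeaklyConvex (x : M → EuclideanSpace ℝ (Fin (n + 1))) : Prop :=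
  ∃ ν : M → EuclideanSpace ℝ (Fin (n + 1)), IsUnitNormalField x ν ∧
    ∀ e ∈ atlas (EuclideanSpace ℝ (Fin n)) M, ∀ p ∈ e.source,
      ∀ v : EuclideanSpace ℝ (Fin n),
        0 ≤ -inner ℝ (secondFundamentalForm (x ∘ e.symm) (e p) v v) (ν p)

/-- `x` is a minimal hypersurface: its mean curvature vector vanishes identically. -/
def IsMinimalHypersurface (x : M → EuclideanSpace ℝ (Fin (n + 1))) : Prop :=
  ∀ e ∈ atlas (EuclideanSpace ℝ (Fin n)) M, ∀ p ∈ e.source,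
    meanCurvatureVector (x ∘ e.symm) (e p) = 0

/-- `x` is a hyperplane: it is an embedding whose image is a (whole) affine hyperplane. -/
def IsHyperplane (x : M → EuclideanSpace ℝ (Fin (n + 1))) : Prop :=
  Topology.IsEmbedding x ∧
    ∃ P : AffineSubspace ℝ (EuclideanSpace ℝ (Fin (n + 1))),
      Module.finrank ℝ P.direction = n ∧ Set.range x = P

end Manifold

end Rotator

end

/-! Put $f=\langle Jx,N\rangle=-H\le 0$. Differentiating twice and using the rotator equation gives,
in local coordinates, $g^{ij}\partial_i\partial_j f=(\text{first order terms in }f)-|A|^2f$, where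
$|A|^2=g^{ij}\langle\partial_iN,\partial_jN\rangle$ (`jacobi_equation`). Skew-symmetry of $J$
removes every other term. As $f\le 0$, the function $-f\ge 0$ is a supersolution of an elliptic
operator without zero order term, so by the strong minimum principle
(`eventually_eq_zero_of_ellipticOp_nonpos`, proved with a Hopf barrier) the zero set of $f$ is open.

That set is also closed, and properness makes it nonempty: $|x|$ attains its minimum, there $x$ is a
multiple of $N$, and $\langle JN,N\rangle=0$. Connectedness then gives $f\equiv 0$, which is
minimality.

If moreover $h\ge 0$ for some unit normal, then $g^{ij}h_{ij}=0$ forces $h=0$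
(`fderiv_normal_eq_zero`). The normal is therefore a constant $\nu_0$, and $x$ has constant height
over $\nu_0^\perp$. The projection to $\nu_0^\perp$ is a proper local homeomorphism, hence a
covering of a simply connected space, hence bijective
(`bijective_of_isProperMap_of_isLocalHomeomorph`); so $x$ is an embedding onto the whole hyperplane.
-/

noncomputable section

namespace Rotator

open scoped Matrix

/-! ### Partial derivatives -/

section PartialDeriv

variable {n : ℕ} {V W : Type*} [NormedAddCommGroup V] [NormedAddCommGroup W]

/-- The `i`-th partial derivative of a function on `ℝⁿ`. -/
def partialDeriv [NormedSpace ℝ V] (i : Fin n) (φ : EuclideanSpace ℝ (Fin n) → V)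
    (u : EuclideanSpace ℝ (Fin n)) : V :=
  fderiv ℝ φ u (EuclideanSpace.single i 1)

variable {U : Set (EuclideanSpace ℝ (Fin n))} {u : EuclideanSpace ℝ (Fin n)}

theorem differentiableAt_of_contDiffOn [NormedSpace ℝ V] {φ : EuclideanSpace ℝ (Fin n) → V}
    (hU : IsOpen U) (hφ : ContDiffOn ℝ ∞ φ U) (hu : u ∈ U) : DifferentiableAt ℝ φ u :=
  (hφ.contDiffAt (hU.mem_nhds hu)).differentiableAt (by simp)

theorem contDiffOn_fderiv [NormedSpace ℝ V] {φ : EuclideanSpace ℝ (Fin n) → V}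
    (hU : IsOpen U) (hφ : ContDiffOn ℝ ∞ φ U) : ContDiffOn ℝ ∞ (fderiv ℝ φ) U :=
  hφ.fderiv_of_isOpen hU (by simp)

theorem contDiffOn_partialDeriv [NormedSpace ℝ V] {φ : EuclideanSpace ℝ (Fin n) → V}
    (hU : IsOpen U) (hφ : ContDiffOn ℝ ∞ φ U) (i : Fin n) :
    ContDiffOn ℝ ∞ (partialDeriv i φ) U :=
  (contDiffOn_fderiv hU hφ).clm_apply contDiffOn_const

theorem fderiv_fderiv_single [NormedSpace ℝ V] {φ : EuclideanSpace ℝ (Fin n) → V}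
    (hU : IsOpen U) (hφ : ContDiffOn ℝ ∞ φ U) (hu : u ∈ U) (i j : Fin n) :
    fderiv ℝ (fderiv ℝ φ) u (EuclideanSpace.single i 1) (EuclideanSpace.single j 1) =
      partialDeriv i (partialDeriv j φ) u := by
  have h := differentiableAt_of_contDiffOn hU (contDiffOn_fderiv hU hφ) hu
  unfold partialDeriv
  rw [fderiv_clm_apply h (differentiableAt_const _)]
  simp

theorem partialDeriv_comm [NormedSpace ℝ V] {φ : EuclideanSpace ℝ (Fin n) → V}
    (hU : IsOpen U) (hφ : ContDiffOn ℝ ∞ φ U) (hu : u ∈ U) (i j : Fin n) :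
    partialDeriv i (partialDeriv j φ) u = partialDeriv j (partialDeriv i φ) u := by
  rw [← fderiv_fderiv_single hU hφ hu, ← fderiv_fderiv_single hU hφ hu]
  exact ((hφ.contDiffAt (hU.mem_nhds hu)).isSymmSndFDerivAt
    (by
      rw [minSmoothness_of_isRCLikeNormedField]
      exact WithTop.coe_le_coe.2 (le_top : (2 : ℕ∞) ≤ ⊤))).eq _ _

theorem partialDeriv_congr [NormedSpace ℝ V] {φ ψ : EuclideanSpace ℝ (Fin n) → V}
    (hU : IsOpen U) (h : ∀ v ∈ U, φ v = ψ v) (hu : u ∈ U) (i : Fin n) :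
    partialDeriv i φ u = partialDeriv i ψ u := by
  have : φ =ᶠ[nhds u] ψ := Filter.eventually_of_mem (hU.mem_nhds hu) h
  unfold partialDeriv
  rw [this.fderiv_eq]

@[simp]
theorem partialDeriv_const [NormedSpace ℝ V] (i : Fin n) (c : V) :
    partialDeriv i (fun _ : EuclideanSpace ℝ (Fin n) => c) u = 0 := by
  simp [partialDeriv]

theorem partialDeriv_inner [InnerProductSpace ℝ V] {φ ψ : EuclideanSpace ℝ (Fin n) → V}
    (hU : IsOpen U) (hφ : ContDiffOn ℝ ∞ φ U) (hψ : ContDiffOn ℝ ∞ ψ U) (hu : u ∈ U) (i : Fin n) :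
    partialDeriv i (fun v => inner ℝ (φ v) (ψ v)) u =
      inner ℝ (partialDeriv i φ u) (ψ u) + inner ℝ (φ u) (partialDeriv i ψ u) := by
  unfold partialDeriv
  rw [fderiv_inner_apply ℝ (differentiableAt_of_contDiffOn hU hφ hu)
    (differentiableAt_of_contDiffOn hU hψ hu), add_comm]

theorem partialDeriv_clm [NormedSpace ℝ V] [NormedSpace ℝ W] {φ : EuclideanSpace ℝ (Fin n) → V}
    (hU : IsOpen U) (hφ : ContDiffOn ℝ ∞ φ U) (hu : u ∈ U) (L : V →L[ℝ] W) (i : Fin n) :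
    partialDeriv i (fun v => L (φ v)) u = L (partialDeriv i φ u) := by
  unfold partialDeriv
  have := (L.hasFDerivAt.comp u (differentiableAt_of_contDiffOn hU hφ hu).hasFDerivAt).fderiv
  change fderiv ℝ (L ∘ φ) u _ = _
  rw [this]; rfl

theorem partialDeriv_add [NormedSpace ℝ V] {φ ψ : EuclideanSpace ℝ (Fin n) → V}
    (hU : IsOpen U) (hφ : ContDiffOn ℝ ∞ φ U) (hψ : ContDiffOn ℝ ∞ ψ U) (hu : u ∈ U) (i : Fin n) :
    partialDeriv i (fun v => φ v + ψ v) u = partialDeriv i φ u + partialDeriv i ψ u := by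
  unfold partialDeriv
  rw [fderiv_fun_add (differentiableAt_of_contDiffOn hU hφ hu)
    (differentiableAt_of_contDiffOn hU hψ hu)]
  rfl

theorem partialDeriv_mul {φ ψ : EuclideanSpace ℝ (Fin n) → ℝ}
    (hU : IsOpen U) (hφ : ContDiffOn ℝ ∞ φ U) (hψ : ContDiffOn ℝ ∞ ψ U) (hu : u ∈ U) (i : Fin n) :
    partialDeriv i (fun v => φ v * ψ v) u =
      partialDeriv i φ u * ψ u + φ u * partialDeriv i ψ u := by
  unfold partialDeriv
  rw [fderiv_fun_mul (differentiableAt_of_contDiffOn hU hφ hu)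
    (differentiableAt_of_contDiffOn hU hψ hu)]
  simp; ring

theorem partialDeriv_sum [NormedSpace ℝ V] {ι : Type*} [Fintype ι]
    {φ : ι → EuclideanSpace ℝ (Fin n) → V}
    (hU : IsOpen U) (hφ : ∀ a, ContDiffOn ℝ ∞ (φ a) U) (hu : u ∈ U) (i : Fin n) :
    partialDeriv i (fun v => ∑ a, φ a v) u = ∑ a, partialDeriv i (φ a) u := by
  unfold partialDeriv
  rw [fderiv_fun_sum fun a _ => differentiableAt_of_contDiffOn hU (hφ a) hu]
  simp

end PartialDeriv

/-! ### Smoothness of the inverse matrix -/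

section Matrix

variable {E : Type*} [NormedAddCommGroup E] [NormedSpace ℝ E] {ι : Type*} [Fintype ι]
  {U : Set E} {A : E → Matrix ι ι ℝ}

theorem contDiffOn_det [DecidableEq ι] (hA : ∀ i j, ContDiffOn ℝ ∞ (fun v => A v i j) U) :
    ContDiffOn ℝ ∞ (fun v => (A v).det) U := by
  simp only [Matrix.det_apply']
  exact ContDiffOn.sum fun σ _ => contDiffOn_const.mul (contDiffOn_prod fun i _ => hA _ _)

/-- Cramer's rule: each entry of the inverse is a quotient of determinants. -/
theorem contDiffOn_matrix_inv [DecidableEq ι]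
    (hA : ∀ i j, ContDiffOn ℝ ∞ (fun v => A v i j) U)
    (hdet : ∀ v ∈ U, (A v).det ≠ 0) (i j : ι) : ContDiffOn ℝ ∞ (fun v => (A v)⁻¹ i j) U := by
  simp only [Matrix.inv_def, Matrix.smul_apply, Ring.inverse_eq_inv', Matrix.adjugate_apply,
    smul_eq_mul]
  refine ((contDiffOn_det hA).inv hdet).mul (contDiffOn_det fun k l => ?_)
  by_cases h : k = j
  · subst h; simpa using contDiffOn_const
  · simpa [Matrix.updateRow_ne h] using hA k l

/-- The trace of the product of two positive semidefinite matrices is nonnegative. -/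
theorem sum_mul_nonneg_of_posSemidef {A B : Matrix ι ι ℝ} (hA : A.PosSemidef)
    (hB : B.PosSemidef) : 0 ≤ ∑ i, ∑ j, A i j * B i j := by
  have h := (hA.hadamard hB).dotProduct_mulVec_nonneg 1
  simpa [dotProduct, Matrix.mulVec, Matrix.hadamard] using h

/-- With $B=D^{T}D$ the sum becomes $\sum_k\langle d_k,Ad_k\rangle$ over the rows $d_k$ of $D$.
Every summand is nonnegative, so all vanish, and definiteness of $A$ kills each row. -/
theorem eq_zero_of_sum_mul_eq_zero {A B : Matrix ι ι ℝ} (hA : A.PosDef)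
    (hB : B.PosSemidef) (h : ∑ i, ∑ j, A i j * B i j = 0) : B = 0 := by
  classical
  have hdec : ∃ D : Matrix ι ι ℝ, B = D.conjTranspose * D := by
    open scoped MatrixOrder Matrix.Norms.L2Operator in
    exact CStarAlgebra.nonneg_iff_eq_star_mul_self.mp hB.nonneg
  obtain ⟨D, rfl⟩ := hdec
  have hsum : ∑ k, star (D k) ⬝ᵥ (A *ᵥ (D k)) = 0 := by
    rw [← h]
    simp only [dotProduct, Matrix.mulVec, Matrix.mul_apply, Matrix.conjTranspose_apply,
      Pi.star_apply, star_trivial, Finset.mul_sum]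
    rw [Finset.sum_comm]
    refine Finset.sum_congr rfl fun i _ => ?_
    rw [Finset.sum_comm]
    refine Finset.sum_congr rfl fun j _ => Finset.sum_congr rfl fun k _ => by ring
  have hD : D = 0 := by
    ext k j
    have h0 := (Finset.sum_eq_zero_iff_of_nonneg
      fun k _ => hA.posSemidef.dotProduct_mulVec_nonneg (D k)).1 hsum k (Finset.mem_univ k)
    by_contra hne
    exact (hA.dotProduct_mulVec_pos (x := D k) fun h => hne (by simp [h])).ne' h0
  simp [hD]

end Matrix

/-! ### Local hypersurfaces with a unit normal field -/

/-- An immersed hypersurface parametrized by an open set, with a smooth unit normal field. -/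
structure IsLocalHypersurface {n : ℕ} (U : Set (EuclideanSpace ℝ (Fin n)))
    (X N : EuclideanSpace ℝ (Fin n) → EuclideanSpace ℝ (Fin (n + 1))) : Prop where
  isOpen : IsOpen U
  smooth : ContDiffOn ℝ ∞ X U
  smooth_normal : ContDiffOn ℝ ∞ N U
  injective : ∀ u ∈ U, Function.Injective (fderiv ℝ X u)
  norm_normal : ∀ u ∈ U, ‖N u‖ = 1
  normal : ∀ u ∈ U, N u ∈ (tangentPlane X u)ᗮ

namespace IsLocalHypersurface

variable {n : ℕ} {U : Set (EuclideanSpace ℝ (Fin n))} {u : EuclideanSpace ℝ (Fin n)}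
  {X N : EuclideanSpace ℝ (Fin n) → EuclideanSpace ℝ (Fin (n + 1))}

theorem inner_fderiv_normal (h : IsLocalHypersurface U X N) (hu : u ∈ U)
    (v : EuclideanSpace ℝ (Fin n)) : inner ℝ (fderiv ℝ X u v) (N u) = 0 :=
  (Submodule.mem_orthogonal _ _).1 (h.normal u hu) _ ⟨v, rfl⟩

theorem inner_partialDeriv_normal (h : IsLocalHypersurface U X N) (hu : u ∈ U) (i : Fin n) :
    inner ℝ (partialDeriv i X u) (N u) = 0 :=
  h.inner_fderiv_normal hu _

theorem inner_normal_normal (h : IsLocalHypersurface U X N) (hu : u ∈ U) :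
    inner ℝ (N u) (N u) = 1 := by
  rw [real_inner_self_eq_norm_sq, h.norm_normal u hu, one_pow]

theorem finrank_tangentPlane (h : IsLocalHypersurface U X N) (hu : u ∈ U) :
    Module.finrank ℝ (tangentPlane X u) = n := by
  unfold tangentPlane
  rw [LinearMap.finrank_range_of_inj (f := (fderiv ℝ X u).toLinearMap) (h.injective u hu)]
  simp

theorem finrank_normalSpace (h : IsLocalHypersurface U X N) (hu : u ∈ U) :
    Module.finrank ℝ (tangentPlane X u)ᗮ = 1 := by
  have := (tangentPlane X u).finrank_add_finrank_orthogonal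
  rw [h.finrank_tangentPlane hu, finrank_euclideanSpace_fin] at this
  omega

/-- Codimension one: the normal space is a line, spanned by the unit vector `N u`. -/
theorem eq_smul_normal (h : IsLocalHypersurface U X N) (hu : u ∈ U)
    {z : EuclideanSpace ℝ (Fin (n + 1))} (hz : z ∈ (tangentPlane X u)ᗮ) :
    z = inner ℝ z (N u) • N u := by
  have hN : (⟨N u, h.normal u hu⟩ : (tangentPlane X u)ᗮ) ≠ 0 := by
    intro h0
    have := h.norm_normal u hu
    rw [show N u = 0 from congrArg Subtype.val h0] at this
    simp at this
  obtain ⟨c, hc⟩ := (finrank_eq_one_iff_of_nonzero' _ hN).1 (h.finrank_normalSpace hu) ⟨z, hz⟩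
  have hc' : c • N u = z := congrArg Subtype.val hc
  rw [← hc', inner_smul_left, h.inner_normal_normal hu]
  simp

theorem normalPart_eq (h : IsLocalHypersurface U X N) (hu : u ∈ U)
    (y : EuclideanSpace ℝ (Fin (n + 1))) : normalPart X u y = inner ℝ y (N u) • N u := by
  have h1 := h.eq_smul_normal hu (z := normalPart X u y)
    ((tangentPlane X u)ᗮ.starProjection_apply_mem y)
  rw [h1]
  congr 1
  unfold normalPart
  rw [Submodule.inner_starProjection_left_eq_right,
    Submodule.starProjection_eq_self_iff.2 (h.normal u hu)]

theorem metricMatrix_apply (i j : Fin n) :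
    metricMatrix X u i j = inner ℝ (partialDeriv i X u) (partialDeriv j X u) := rfl

theorem metricMatrix_posDef (h : IsLocalHypersurface U X N) (hu : u ∈ U) :
    (metricMatrix X u).PosDef := by
  have hli : LinearIndependent ℝ fun i => partialDeriv i X u := by
    have := (EuclideanSpace.basisFun (Fin n) ℝ).toBasis.linearIndependent.map'
      (fderiv ℝ X u).toLinearMap (LinearMap.ker_eq_bot.2 (h.injective u hu))
    have he : (fun i => partialDeriv i X u) =
        (fderiv ℝ X u).toLinearMap ∘ (EuclideanSpace.basisFun (Fin n) ℝ).toBasis := by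
      ext1 i
      simp [partialDeriv]
    rwa [he]
  exact Matrix.posDef_gram_of_linearIndependent hli

theorem inv_metricMatrix_posDef (h : IsLocalHypersurface U X N) (hu : u ∈ U) :
    (metricMatrix X u)⁻¹.PosDef :=
  (h.metricMatrix_posDef hu).inv

theorem inv_metricMatrix_comm (h : IsLocalHypersurface U X N) (hu : u ∈ U) (i j : Fin n) :
    (metricMatrix X u)⁻¹ i j = (metricMatrix X u)⁻¹ j i := by
  simpa using ((h.inv_metricMatrix_posDef hu).isHermitian.apply i j).symm

theorem inv_metricMatrix_mul (h : IsLocalHypersurface U X N) (hu : u ∈ U) :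
    (metricMatrix X u)⁻¹ * metricMatrix X u = 1 :=
  Matrix.nonsing_inv_mul _ (h.metricMatrix_posDef hu).det_pos.ne'.isUnit

theorem contDiffOn_metricMatrix (h : IsLocalHypersurface U X N) (i j : Fin n) :
    ContDiffOn ℝ ∞ (fun v => metricMatrix X v i j) U :=
  (contDiffOn_partialDeriv h.isOpen h.smooth i).inner ℝ
    (contDiffOn_partialDeriv h.isOpen h.smooth j)

theorem contDiffOn_inv_metricMatrix (h : IsLocalHypersurface U X N) (i j : Fin n) :
    ContDiffOn ℝ ∞ (fun v => (metricMatrix X v)⁻¹ i j) U :=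
  contDiffOn_matrix_inv h.contDiffOn_metricMatrix
    (fun _ hv => (h.metricMatrix_posDef hv).det_pos.ne') i j

/-- The decomposition of a vector into its normal and tangential parts. -/
theorem eq_normal_add_tangential (h : IsLocalHypersurface U X N) (hu : u ∈ U)
    (y : EuclideanSpace ℝ (Fin (n + 1))) :
    y = inner ℝ y (N u) • N u +
      ∑ l, (∑ m, (metricMatrix X u)⁻¹ l m * inner ℝ y (partialDeriv m X u)) •
        partialDeriv l X u := by
  set T := ∑ l, (∑ m, (metricMatrix X u)⁻¹ l m * inner ℝ y (partialDeriv m X u)) •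
        partialDeriv l X u with hT
  have hTX : ∀ k, inner ℝ T (partialDeriv k X u) = inner ℝ y (partialDeriv k X u) := by
    intro k
    have hk : ∀ m, ∑ l, (metricMatrix X u)⁻¹ m l * metricMatrix X u l k =
        if m = k then 1 else 0 := by
      intro m
      have := congrFun (congrFun (h.inv_metricMatrix_mul hu) m) k
      rwa [Matrix.mul_apply, Matrix.one_apply] at this
    simp only [hT, sum_inner, inner_smul_left, Finset.sum_mul, RCLike.conj_to_real,
      ← metricMatrix_apply]
    rw [Finset.sum_comm]
    calc _ = ∑ m, inner ℝ y (partialDeriv m X u) *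
            ∑ l, (metricMatrix X u)⁻¹ m l * metricMatrix X u l k := by
          refine Finset.sum_congr rfl fun m _ => ?_
          rw [Finset.mul_sum]
          refine Finset.sum_congr rfl fun l _ => ?_
          rw [h.inv_metricMatrix_comm hu l m]; ring
      _ = _ := by simp [hk]
  -- `T` has the same products with all $\partial_kX$ as `y`, so the difference is normal.
  have hz : y - T ∈ (tangentPlane X u)ᗮ := by
    rw [Submodule.mem_orthogonal]
    rintro _ ⟨v, rfl⟩
    have hv : v = ∑ i, v i • EuclideanSpace.single i (1 : ℝ) := by
      simpa using ((EuclideanSpace.basisFun (Fin n) ℝ).sum_repr v).symm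
    rw [hv]
    simp only [ContinuousLinearMap.coe_coe, map_sum, map_smul, sum_inner, inner_smul_left]
    refine Finset.sum_eq_zero fun i _ => ?_
    have := hTX i
    rw [real_inner_comm, inner_sub_left]
    unfold partialDeriv at this
    rw [this]; simp
  have hTN : inner ℝ T (N u) = 0 := by
    simp [hT, sum_inner, inner_smul_left, h.inner_partialDeriv_normal hu]
  have := h.eq_smul_normal hu hz
  rw [inner_sub_left, hTN, sub_zero] at this
  rw [← this]; simp

theorem secondFundamentalForm_single (h : IsLocalHypersurface U X N) (hu : u ∈ U) (i j : Fin n) :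
    inner ℝ (secondFundamentalForm X u (EuclideanSpace.single i 1) (EuclideanSpace.single j 1))
      (N u) = inner ℝ (partialDeriv i (partialDeriv j X) u) (N u) := by
  unfold secondFundamentalForm
  rw [h.normalPart_eq hu, inner_smul_left, h.inner_normal_normal hu,
    fderiv_fderiv_single h.isOpen h.smooth hu]
  simp

theorem inner_meanCurvatureVector (h : IsLocalHypersurface U X N) (hu : u ∈ U) :
    inner ℝ (meanCurvatureVector X u) (N u) = ∑ i, ∑ j, (metricMatrix X u)⁻¹ i j *
      inner ℝ (partialDeriv i (partialDeriv j X) u) (N u) := by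
  simp [meanCurvatureVector, sum_inner, inner_smul_left, h.secondFundamentalForm_single hu]

theorem inner_fderiv_normal_normal (h : IsLocalHypersurface U X N) (hu : u ∈ U) (i : Fin n) :
    inner ℝ (partialDeriv i N u) (N u) = 0 := by
  have h1 := partialDeriv_inner h.isOpen h.smooth_normal h.smooth_normal hu i
  have h2 := partialDeriv_congr h.isOpen (fun v hv => h.inner_normal_normal hv) hu i
  rw [h2, partialDeriv_const, real_inner_comm] at h1
  linarith [real_inner_comm (N u) (partialDeriv i N u)]

/-- The Weingarten relation. -/
theorem inner_partialDeriv_partialDeriv_normal (h : IsLocalHypersurface U X N) (hu : u ∈ U)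
    (i j : Fin n) :
    inner ℝ (partialDeriv i (partialDeriv j X) u) (N u) =
      -inner ℝ (partialDeriv j X u) (partialDeriv i N u) := by
  have h1 := partialDeriv_inner h.isOpen (contDiffOn_partialDeriv h.isOpen h.smooth j)
    h.smooth_normal hu i
  have h2 := partialDeriv_congr h.isOpen (fun v hv => h.inner_partialDeriv_normal hv j) hu i
  rw [h2, partialDeriv_const] at h1
  linarith

end IsLocalHypersurface

/-! ### Dual frames and the Jacobi equation for a rotation field -/

/-- The dual frame `∂ⁱX = g^{ij} ∂ⱼX`. -/
def dualFrame {n : ℕ} (X : EuclideanSpace ℝ (Fin n) → EuclideanSpace ℝ (Fin (n + 1)))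
    (u : EuclideanSpace ℝ (Fin n)) (i : Fin n) : EuclideanSpace ℝ (Fin (n + 1)) :=
  ∑ j, (metricMatrix X u)⁻¹ i j • partialDeriv j X u

/-- The coordinate trace `g^{ij} ∂ᵢ∂ⱼX` of the second derivative. -/
def coordLaplacian {n : ℕ} (X : EuclideanSpace ℝ (Fin n) → EuclideanSpace ℝ (Fin (n + 1)))
    (u : EuclideanSpace ℝ (Fin n)) : EuclideanSpace ℝ (Fin (n + 1)) :=
  ∑ i, ∑ j, (metricMatrix X u)⁻¹ i j • partialDeriv i (partialDeriv j X) u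

theorem sum_mul_comm_of_symm {n : ℕ} {G : Matrix (Fin n) (Fin n) ℝ} (hG : ∀ i j, G i j = G j i)
    (T : Fin n → Fin n → ℝ) : ∑ i, ∑ j, G i j * T i j = ∑ i, ∑ j, G i j * T j i := by
  rw [Finset.sum_comm]
  exact Finset.sum_congr rfl fun i _ => Finset.sum_congr rfl fun j _ => by rw [hG]

theorem trace_mul_transpose_eq_sum {n : ℕ} (A B : Matrix (Fin n) (Fin n) ℝ) :
    (A * Bᵀ).trace = ∑ i, ∑ j, B i j * A i j := by
  simp [Matrix.trace, Matrix.mul_apply, mul_comm]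

namespace IsLocalHypersurface

variable {n : ℕ} {U : Set (EuclideanSpace ℝ (Fin n))} {u : EuclideanSpace ℝ (Fin n)}
  {X N : EuclideanSpace ℝ (Fin n) → EuclideanSpace ℝ (Fin (n + 1))}

theorem inner_dualFrame (y : EuclideanSpace ℝ (Fin (n + 1))) (l : Fin n) :
    inner ℝ y (dualFrame X u l) =
      ∑ m, (metricMatrix X u)⁻¹ l m * inner ℝ y (partialDeriv m X u) := by
  simp [dualFrame, inner_sum, inner_smul_right]

theorem eq_normal_add_sum_frame (h : IsLocalHypersurface U X N) (hu : u ∈ U)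
    (y : EuclideanSpace ℝ (Fin (n + 1))) :
    y = inner ℝ y (N u) • N u + ∑ l, inner ℝ y (dualFrame X u l) • partialDeriv l X u := by
  simp only [inner_dualFrame]
  exact h.eq_normal_add_tangential hu y

theorem eq_normal_add_sum_dualFrame (h : IsLocalHypersurface U X N) (hu : u ∈ U)
    (y : EuclideanSpace ℝ (Fin (n + 1))) :
    y = inner ℝ y (N u) • N u + ∑ l, inner ℝ y (partialDeriv l X u) • dualFrame X u l := by
  conv_lhs => rw [h.eq_normal_add_tangential hu y]
  congr 1
  simp only [dualFrame, Finset.smul_sum, Finset.sum_smul, smul_smul]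
  rw [Finset.sum_comm]
  refine Finset.sum_congr rfl fun i _ => Finset.sum_congr rfl fun j _ => ?_
  rw [h.inv_metricMatrix_comm hu, mul_comm]

theorem normal_deriv_eq_sum_frame (h : IsLocalHypersurface U X N) (hu : u ∈ U) (i : Fin n) :
    partialDeriv i N u = ∑ l, inner ℝ (partialDeriv i N u) (dualFrame X u l) •
      partialDeriv l X u := by
  conv_lhs => rw [h.eq_normal_add_sum_frame hu (partialDeriv i N u)]
  rw [h.inner_fderiv_normal_normal hu, zero_smul, zero_add]

theorem normal_deriv_eq_sum_dualFrame (h : IsLocalHypersurface U X N) (hu : u ∈ U) (i : Fin n) :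
    partialDeriv i N u = ∑ l, inner ℝ (partialDeriv i N u) (partialDeriv l X u) •
      dualFrame X u l := by
  conv_lhs => rw [h.eq_normal_add_sum_dualFrame hu (partialDeriv i N u)]
  rw [h.inner_fderiv_normal_normal hu, zero_smul, zero_add]

/-- Symmetry of the shape operator, from the Weingarten relation and the symmetry of second
derivatives of $X$. -/
theorem inner_normal_deriv_comm (h : IsLocalHypersurface U X N) (hu : u ∈ U) (i j : Fin n) :
    inner ℝ (partialDeriv i N u) (partialDeriv j X u) =
      inner ℝ (partialDeriv j N u) (partialDeriv i X u) := by
  have h1 := h.inner_partialDeriv_partialDeriv_normal hu i j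
  have h2 := h.inner_partialDeriv_partialDeriv_normal hu j i
  rw [partialDeriv_comm h.isOpen h.smooth hu] at h1
  rw [real_inner_comm, real_inner_comm (partialDeriv i X u)]
  linarith

/-- The derivative of the inverse metric. -/
theorem partialDeriv_inv_metricMatrix (h : IsLocalHypersurface U X N) (hu : u ∈ U) (k : Fin n) :
    (Matrix.of fun i j => partialDeriv k (fun v => (metricMatrix X v)⁻¹ i j) u) =
      -((metricMatrix X u)⁻¹ * (Matrix.of fun i j =>
          inner ℝ (partialDeriv k (partialDeriv i X) u) (partialDeriv j X u) +
          inner ℝ (partialDeriv i X u) (partialDeriv k (partialDeriv j X) u)) *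
        (metricMatrix X u)⁻¹) := by
  set dG := (Matrix.of fun i j => partialDeriv k (fun v => (metricMatrix X v)⁻¹ i j) u)
  set dg := (Matrix.of fun i j =>
          inner ℝ (partialDeriv k (partialDeriv i X) u) (partialDeriv j X u) +
          inner ℝ (partialDeriv i X u) (partialDeriv k (partialDeriv j X) u))
  -- The derivative of the identity $g^{-1}g=1$.
  have hkey : dG * metricMatrix X u + (metricMatrix X u)⁻¹ * dg = 0 := by
    ext i j
    have h1 : partialDeriv k (fun v => ∑ a, (metricMatrix X v)⁻¹ i a * metricMatrix X v a j) u =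
        0 := by
      rw [partialDeriv_congr h.isOpen (ψ := fun _ => (1 : Matrix (Fin n) (Fin n) ℝ) i j) _ hu]
      · simp
      · intro v hv
        rw [← h.inv_metricMatrix_mul hv, Matrix.mul_apply]
    rw [partialDeriv_sum h.isOpen (fun a => (h.contDiffOn_inv_metricMatrix i a).mul
      (h.contDiffOn_metricMatrix a j)) hu] at h1
    rw [Matrix.add_apply, Matrix.mul_apply, Matrix.mul_apply, ← Finset.sum_add_distrib,
      Matrix.zero_apply, ← h1]
    refine Finset.sum_congr rfl fun a _ => ?_
    rw [partialDeriv_mul h.isOpen (h.contDiffOn_inv_metricMatrix i a)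
      (h.contDiffOn_metricMatrix a j) hu]
    congr 2
    exact (partialDeriv_inner h.isOpen (contDiffOn_partialDeriv h.isOpen h.smooth a)
      (contDiffOn_partialDeriv h.isOpen h.smooth j) hu k).symm
  have hinv : metricMatrix X u * (metricMatrix X u)⁻¹ = 1 :=
    Matrix.mul_nonsing_inv _ (h.metricMatrix_posDef hu).det_pos.ne'.isUnit
  have := congrArg (· * (metricMatrix X u)⁻¹) hkey
  simp only [add_mul, zero_mul, mul_assoc, hinv, mul_one] at this
  rw [mul_assoc]
  exact eq_neg_of_add_eq_zero_left this

/-- Insert $\partial_k g^{-1}=-g^{-1}(\partial_kg)g^{-1}$ and move both factors $g^{-1}$ onto the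
shape operator by cyclicity of the trace. The two halves of $\partial_kg_{ab}$ contribute equally,
whence the factor 2. The term is needed to cancel the cross terms in the gradient of the mean
curvature. -/
theorem sum_partialDeriv_inv_metricMatrix (h : IsLocalHypersurface U X N) (hu : u ∈ U)
    (k : Fin n) :
    ∑ i, ∑ j, partialDeriv k (fun v => (metricMatrix X v)⁻¹ i j) u *
        inner ℝ (partialDeriv i (partialDeriv j X) u) (N u) =
      2 * ∑ i, ∑ j, (metricMatrix X u)⁻¹ i j *
        inner ℝ (partialDeriv k (partialDeriv i X) u) (partialDeriv j N u) := by
  set G := (metricMatrix X u)⁻¹ with hG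
  set dg := (Matrix.of fun i j =>
          inner ℝ (partialDeriv k (partialDeriv i X) u) (partialDeriv j X u) +
          inner ℝ (partialDeriv i X u) (partialDeriv k (partialDeriv j X) u)) with hdg
  set W : Matrix (Fin n) (Fin n) ℝ := Matrix.of fun i j =>
    inner ℝ (partialDeriv i N u) (partialDeriv j X u) with hW
  have hGs : Gᵀ = G := by ext i j; exact h.inv_metricMatrix_comm hu j i
  have hWs : Wᵀ = W := by ext i j; exact h.inner_normal_deriv_comm hu j i
  have hSs : (G * W * G)ᵀ = G * W * G := by
    rw [Matrix.transpose_mul, Matrix.transpose_mul, hGs, hWs, mul_assoc]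
  have hd := h.partialDeriv_inv_metricMatrix hu k
  rw [← hG, ← hdg] at hd
  -- $\partial_iN$ is tangential with frame coefficients $Wg^{-1}$, so the doubly raised shape
  -- operator contracted with the frame is again a derivative of $N$.
  have hframe : ∀ a, ∑ b, (G * W * G) a b • partialDeriv b X u =
      ∑ i, G a i • partialDeriv i N u := by
    intro a
    have hN : ∀ i, partialDeriv i N u = ∑ b, (W * G) i b • partialDeriv b X u := by
      intro i
      conv_lhs => rw [h.normal_deriv_eq_sum_frame hu i]
      refine Finset.sum_congr rfl fun b _ => ?_
      rw [inner_dualFrame, Matrix.mul_apply]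
      congr 1
      refine Finset.sum_congr rfl fun m _ => ?_
      rw [h.inv_metricMatrix_comm hu, mul_comm]; rfl
    simp_rw [hN, Finset.smul_sum, smul_smul]
    rw [Finset.sum_comm]
    refine Finset.sum_congr rfl fun b _ => ?_
    rw [mul_assoc, Matrix.mul_apply, Finset.sum_smul]
  have hS : ∀ a b, (G * W * G) a b = (G * W * G) b a := fun a b => by
    conv_lhs => rw [← hSs]
    rfl
  calc _ = -∑ i, ∑ j, (-(G * dg * G)) i j * W i j := by
        rw [← hd, ← Finset.sum_neg_distrib]
        refine Finset.sum_congr rfl fun i _ => ?_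
        rw [← Finset.sum_neg_distrib]
        refine Finset.sum_congr rfl fun j _ => ?_
        rw [h.inner_partialDeriv_partialDeriv_normal hu, real_inner_comm]
        simp [hW]
    _ = Matrix.trace (G * dg * G * Wᵀ) := by
        rw [trace_mul_transpose_eq_sum, ← Finset.sum_neg_distrib]
        refine Finset.sum_congr rfl fun i _ => ?_
        rw [← Finset.sum_neg_distrib]
        refine Finset.sum_congr rfl fun j _ => ?_
        rw [Matrix.neg_apply]
        ring
    _ = Matrix.trace (dg * (G * W * G)ᵀ) := by
        rw [hWs, hSs, mul_assoc, mul_assoc, Matrix.trace_mul_comm, mul_assoc, mul_assoc]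
    _ = ∑ a, ∑ b, (G * W * G) a b * dg a b := by
        rw [trace_mul_transpose_eq_sum]
    _ = 2 * ∑ a, ∑ b, (G * W * G) a b *
          inner ℝ (partialDeriv k (partialDeriv a X) u) (partialDeriv b X u) := by
        simp only [hdg, Matrix.of_apply, mul_add, Finset.sum_add_distrib, two_mul]
        congr 1
        rw [sum_mul_comm_of_symm hS]
        refine Finset.sum_congr rfl fun a _ => Finset.sum_congr rfl fun b _ => ?_
        rw [real_inner_comm]
    _ = _ := by
        congr 1
        refine Finset.sum_congr rfl fun a _ => ?_
        have := congrArg (inner ℝ (partialDeriv k (partialDeriv a X) u)) (hframe a)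
        simpa [inner_sum, inner_smul_right] using this

/-- The tangential part of `g^{ij} ∂ᵢ∂ⱼN` is the gradient of the mean curvature up to first
order terms. -/
theorem sum_inner_normal_deriv_deriv (h : IsLocalHypersurface U X N) (hu : u ∈ U) (k : Fin n) :
    ∑ i, ∑ j, (metricMatrix X u)⁻¹ i j *
        inner ℝ (partialDeriv k X u) (partialDeriv i (partialDeriv j N) u) =
      -partialDeriv k (fun v => ∑ i, ∑ j, (metricMatrix X v)⁻¹ i j *
        inner ℝ (partialDeriv i (partialDeriv j X) v) (N v)) u +
      inner ℝ (coordLaplacian X u) (partialDeriv k N u) := by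
  have hX1 := fun i => contDiffOn_partialDeriv h.isOpen h.smooth i
  have hX2 := fun i j => contDiffOn_partialDeriv h.isOpen (hX1 j) i
  have hN1 := fun i => contDiffOn_partialDeriv h.isOpen h.smooth_normal i
  have hXN := fun i j => (hX2 i j).inner ℝ h.smooth_normal
  have hGXN := fun i j => (h.contDiffOn_inv_metricMatrix i j).mul (hXN i j)
  have h1 : partialDeriv k (fun v => ∑ i, ∑ j, (metricMatrix X v)⁻¹ i j *
        inner ℝ (partialDeriv i (partialDeriv j X) v) (N v)) u =
      ∑ i, ∑ j, partialDeriv k (fun v => (metricMatrix X v)⁻¹ i j) u *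
        inner ℝ (partialDeriv i (partialDeriv j X) u) (N u) +
      ∑ i, ∑ j, (metricMatrix X u)⁻¹ i j *
        inner ℝ (partialDeriv k (partialDeriv i (partialDeriv j X)) u) (N u) +
      inner ℝ (coordLaplacian X u) (partialDeriv k N u) := by
    rw [partialDeriv_sum h.isOpen (fun i => ContDiffOn.sum fun j _ => hGXN i j) hu]
    simp only [coordLaplacian, sum_inner, inner_smul_left, ← Finset.sum_add_distrib,
      RCLike.conj_to_real]
    refine Finset.sum_congr rfl fun i _ => ?_
    rw [partialDeriv_sum h.isOpen (fun j => hGXN i j) hu]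
    refine Finset.sum_congr rfl fun j _ => ?_
    rw [partialDeriv_mul h.isOpen (h.contDiffOn_inv_metricMatrix i j) (hXN i j) hu,
      partialDeriv_inner h.isOpen (hX2 i j) h.smooth_normal hu]
    ring
  -- The $i$-th derivative of the Weingarten relation for the indices $j,k$, with the third
  -- derivatives of $X$ reordered.
  have h2 : ∀ i j, inner ℝ (partialDeriv k (partialDeriv i (partialDeriv j X)) u) (N u) =
      -inner ℝ (partialDeriv k (partialDeriv j X) u) (partialDeriv i N u) -
      inner ℝ (partialDeriv k (partialDeriv i X) u) (partialDeriv j N u) -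
      inner ℝ (partialDeriv k X u) (partialDeriv i (partialDeriv j N) u) := by
    intro i j
    have e1 := partialDeriv_inner h.isOpen (hX2 j k) h.smooth_normal hu i
    have e2 := partialDeriv_inner h.isOpen (hX1 k) (hN1 j) hu i
    have e3 := partialDeriv_congr h.isOpen
      (fun v hv => eq_neg_iff_add_eq_zero.1 (h.inner_partialDeriv_partialDeriv_normal hv j k)) hu i
    rw [partialDeriv_add h.isOpen (hXN j k) ((hX1 k).inner ℝ (hN1 j)) hu, partialDeriv_const,
      e1, e2] at e3
    have e4 : partialDeriv k (partialDeriv i (partialDeriv j X)) u =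
        partialDeriv i (partialDeriv j (partialDeriv k X)) u := by
      rw [partialDeriv_comm h.isOpen (hX1 j) hu]
      exact partialDeriv_congr h.isOpen
        (fun v hv => partialDeriv_comm h.isOpen h.smooth hv k j) hu i
    rw [e4, partialDeriv_comm h.isOpen h.smooth hu k j, partialDeriv_comm h.isOpen h.smooth hu k i]
    linarith
  have h3 := h.sum_partialDeriv_inv_metricMatrix hu k
  -- After contraction the two cross terms of `h2` agree, and together they cancel the sum in `h3`.
  have h4 := sum_mul_comm_of_symm (h.inv_metricMatrix_comm hu)
    (fun i j => inner ℝ (partialDeriv k (partialDeriv j X) u) (partialDeriv i N u))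
  simp only [h2, mul_sub, mul_neg, Finset.sum_sub_distrib, Finset.sum_neg_distrib] at h1
  linarith

/-- The equation satisfied by the normal component of a rotation field on a rotator. -/
theorem jacobi_equation (h : IsLocalHypersurface U X N) (hu : u ∈ U)
    (J : EuclideanSpace ℝ (Fin (n + 1)) →L[ℝ] EuclideanSpace ℝ (Fin (n + 1)))
    (hJ : ∀ y z, inner ℝ (J y) z = -inner ℝ y (J z))
    (hH : ∀ v ∈ U, ∑ i, ∑ j, (metricMatrix X v)⁻¹ i j *
      inner ℝ (partialDeriv i (partialDeriv j X) v) (N v) = inner ℝ (J (X v)) (N v)) :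
    ∑ i, ∑ j, (metricMatrix X u)⁻¹ i j *
        partialDeriv i (partialDeriv j fun v => inner ℝ (J (X v)) (N v)) u =
      ∑ l, inner ℝ (coordLaplacian X u - J (X u)) (dualFrame X u l) *
        partialDeriv l (fun v => inner ℝ (J (X v)) (N v)) u -
      (∑ i, ∑ j, (metricMatrix X u)⁻¹ i j * inner ℝ (partialDeriv i N u) (partialDeriv j N u)) *
        inner ℝ (J (X u)) (N u) := by
  have hX1 := fun i => contDiffOn_partialDeriv h.isOpen h.smooth i
  have hN1 := fun i => contDiffOn_partialDeriv h.isOpen h.smooth_normal i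
  have hJX : ContDiffOn ℝ ∞ (fun v => J (X v)) U := J.contDiff.comp_contDiffOn h.smooth
  have hJX1 : ∀ i, ContDiffOn ℝ ∞ (fun v => J (partialDeriv i X v)) U :=
    fun i => J.contDiff.comp_contDiffOn (hX1 i)
  have hJself : ∀ y, inner ℝ (J y) y = 0 := fun y => by
    linarith [hJ y y, real_inner_comm y (J y)]
  have hf1 : ∀ l, ∀ v ∈ U, partialDeriv l (fun v => inner ℝ (J (X v)) (N v)) v =
      inner ℝ (J (partialDeriv l X v)) (N v) + inner ℝ (J (X v)) (partialDeriv l N v) :=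
    fun l v hv => by
      rw [partialDeriv_inner h.isOpen hJX h.smooth_normal hv,
        partialDeriv_clm h.isOpen h.smooth hv]
  have hf2 : ∀ i j, partialDeriv i (partialDeriv j fun v => inner ℝ (J (X v)) (N v)) u =
      inner ℝ (J (partialDeriv i (partialDeriv j X) u)) (N u) +
      inner ℝ (J (partialDeriv j X u)) (partialDeriv i N u) +
      inner ℝ (J (partialDeriv i X u)) (partialDeriv j N u) +
      inner ℝ (J (X u)) (partialDeriv i (partialDeriv j N) u) := by
    intro i j
    rw [partialDeriv_congr h.isOpen (hf1 j) hu,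
      partialDeriv_add h.isOpen ((hJX1 j).inner ℝ h.smooth_normal) (hJX.inner ℝ (hN1 j)) hu,
      partialDeriv_inner h.isOpen (hJX1 j) h.smooth_normal hu,
      partialDeriv_inner h.isOpen hJX (hN1 j) hu, partialDeriv_clm h.isOpen (hX1 j) hu,
      partialDeriv_clm h.isOpen h.smooth hu]
    ring
  -- Only the tangential part of $g^{ij}\partial_i\partial_jX$ survives, because $\langle
  -- JN,N\rangle=0$.
  have hA : ∑ i, ∑ j, (metricMatrix X u)⁻¹ i j *
        inner ℝ (J (partialDeriv i (partialDeriv j X) u)) (N u) =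
      ∑ l, inner ℝ (coordLaplacian X u) (dualFrame X u l) *
        inner ℝ (J (partialDeriv l X u)) (N u) := by
    have e := congrArg (fun y => inner ℝ (J y) (N u))
      (h.eq_normal_add_sum_frame hu (coordLaplacian X u))
    simp only [map_add, map_smul, map_sum, inner_add_left, inner_smul_left, sum_inner,
      RCLike.conj_to_real, hJself, mul_zero, zero_add] at e
    rw [← e]
    simp [coordLaplacian, sum_inner, inner_smul_left]
  -- The skew form of $J$ contracted with the symmetric shape operator.
  have hB : ∑ i, ∑ j, (metricMatrix X u)⁻¹ i j *
        inner ℝ (J (partialDeriv j X u)) (partialDeriv i N u) = 0 := by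
    have e : ∑ i, ∑ j, (metricMatrix X u)⁻¹ i j *
        inner ℝ (J (partialDeriv j X u)) (partialDeriv i N u) =
        ∑ i, ∑ l, inner ℝ (partialDeriv i N u) (partialDeriv l X u) *
          inner ℝ (J (dualFrame X u i)) (dualFrame X u l) := by
      refine Finset.sum_congr rfl fun i _ => ?_
      have e1 := congrArg (inner ℝ (J (dualFrame X u i))) (h.normal_deriv_eq_sum_dualFrame hu i)
      simp only [inner_sum, inner_smul_right] at e1
      rw [← e1]
      simp [dualFrame, sum_inner, inner_smul_left]
    have e2 := sum_mul_comm_of_symm (G := Matrix.of fun i l =>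
      inner ℝ (partialDeriv i N u) (partialDeriv l X u)) (h.inner_normal_deriv_comm hu)
      (fun i l => inner ℝ (J (dualFrame X u i)) (dualFrame X u l))
    have e3 : ∀ i l, inner ℝ (J (dualFrame X u l)) (dualFrame X u i) =
        -inner ℝ (J (dualFrame X u i)) (dualFrame X u l) := fun i l => by
      rw [hJ, real_inner_comm]
    have e4 : ∑ i, ∑ l, inner ℝ (partialDeriv i N u) (partialDeriv l X u) *
          inner ℝ (J (dualFrame X u l)) (dualFrame X u i) =
        -∑ i, ∑ l, inner ℝ (partialDeriv i N u) (partialDeriv l X u) *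
          inner ℝ (J (dualFrame X u i)) (dualFrame X u l) := by
      simp only [← Finset.sum_neg_distrib]
      refine Finset.sum_congr rfl fun i _ => Finset.sum_congr rfl fun l _ => ?_
      rw [e3, mul_neg]
    simp only [Matrix.of_apply] at e2
    rw [e]
    linarith
  have hB' := hB
  rw [sum_mul_comm_of_symm (h.inv_metricMatrix_comm hu)
    (fun i j => inner ℝ (J (partialDeriv j X u)) (partialDeriv i N u))] at hB'
  have hNN : ∀ i j, inner ℝ (N u) (partialDeriv i (partialDeriv j N) u) =
      -inner ℝ (partialDeriv i N u) (partialDeriv j N u) := by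
    intro i j
    have e1 := partialDeriv_inner h.isOpen (hN1 j) h.smooth_normal hu i
    rw [partialDeriv_congr h.isOpen (fun v hv => h.inner_fderiv_normal_normal hv j) hu,
      partialDeriv_const] at e1
    rw [real_inner_comm, real_inner_comm (partialDeriv j N u)]
    linarith
  -- Split $JX$ into normal and tangential parts. The normal part produces $-|A|^2f$; in the
  -- tangential part the rotator equation turns the gradient of the mean curvature into that of $f$.
  have hC : ∑ i, ∑ j, (metricMatrix X u)⁻¹ i j *
        inner ℝ (J (X u)) (partialDeriv i (partialDeriv j N) u) =
      -((∑ i, ∑ j, (metricMatrix X u)⁻¹ i j * inner ℝ (partialDeriv i N u) (partialDeriv j N u)) *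
        inner ℝ (J (X u)) (N u)) +
      ∑ k, inner ℝ (J (X u)) (dualFrame X u k) *
        (-partialDeriv k (fun v => inner ℝ (J (X v)) (N v)) u +
          inner ℝ (coordLaplacian X u) (partialDeriv k N u)) := by
    set Z := ∑ i, ∑ j, (metricMatrix X u)⁻¹ i j • partialDeriv i (partialDeriv j N) u with hZ
    have hin : ∀ y, ∑ i, ∑ j, (metricMatrix X u)⁻¹ i j *
        inner ℝ y (partialDeriv i (partialDeriv j N) u) = inner ℝ y Z := fun y => by
      simp [hZ, inner_sum, inner_smul_right]
    have hZN : inner ℝ (N u) Z = -∑ i, ∑ j, (metricMatrix X u)⁻¹ i j *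
        inner ℝ (partialDeriv i N u) (partialDeriv j N u) := by
      rw [← hin]
      simp [hNN]
    have hZX : ∀ k, inner ℝ (partialDeriv k X u) Z =
        -partialDeriv k (fun v => inner ℝ (J (X v)) (N v)) u +
          inner ℝ (coordLaplacian X u) (partialDeriv k N u) := fun k => by
      rw [← hin, h.sum_inner_normal_deriv_deriv hu k, partialDeriv_congr h.isOpen hH hu]
    have e := congrArg (fun y => inner ℝ y Z) (h.eq_normal_add_sum_frame hu (J (X u)))
    simp only [inner_add_left, inner_smul_left, sum_inner, RCLike.conj_to_real] at e
    rw [hin, e, hZN]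
    simp only [hZX]
    ring
  -- Self-adjointness of the shape operator. With `hA` this reassembles $\partial_lf=\langle
  -- J\partial_lX,N\rangle+\langle JX,\partial_lN\rangle$.
  have hD : ∑ k, inner ℝ (J (X u)) (dualFrame X u k) *
        inner ℝ (coordLaplacian X u) (partialDeriv k N u) =
      ∑ l, inner ℝ (coordLaplacian X u) (dualFrame X u l) *
        inner ℝ (J (X u)) (partialDeriv l N u) := by
    have e1 : ∀ y k, inner ℝ y (partialDeriv k N u) =
        ∑ l, inner ℝ (partialDeriv k N u) (partialDeriv l X u) * inner ℝ y (dualFrame X u l) := by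
      intro y k
      have := congrArg (inner ℝ y) (h.normal_deriv_eq_sum_dualFrame hu k)
      simpa only [inner_sum, inner_smul_right] using this
    simp only [e1, Finset.mul_sum]
    rw [Finset.sum_comm]
    refine Finset.sum_congr rfl fun l _ => Finset.sum_congr rfl fun k _ => ?_
    rw [h.inner_normal_deriv_comm hu k l]
    ring
  simp only [hf2, mul_add, Finset.sum_add_distrib, hA, hB, hB', hC, hD, mul_neg, inner_sub_left,
    sub_mul, Finset.sum_sub_distrib, Finset.sum_neg_distrib]
  simp only [hf1 _ u hu, mul_add, Finset.sum_add_distrib]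
  ring

end IsLocalHypersurface

/-! ### The strong minimum principle -/

section SecondDerivativeTest

variable {n : ℕ} {U : Set (EuclideanSpace ℝ (Fin n))} {y : EuclideanSpace ℝ (Fin n)}
  {φ : EuclideanSpace ℝ (Fin n) → ℝ}

/-- Restrict to a line. A negative second derivative would make the point a local maximum as well,
so the restriction would be locally constant, with second derivative zero. -/
theorem fderiv_fderiv_nonneg_of_isLocalMin (hU : IsOpen U) (hφ : ContDiffOn ℝ ∞ φ U) (hy : y ∈ U)
    (hmin : IsLocalMin φ y) (v : EuclideanSpace ℝ (Fin n)) :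
    0 ≤ fderiv ℝ (fderiv ℝ φ) y v v := by
  have hline : ∀ t : ℝ, HasDerivAt (fun t : ℝ => y + t • v) v t := fun t => by
    simpa using ((hasDerivAt_id t).smul_const v).const_add y
  have hcont : Continuous fun t : ℝ => y + t • v := by fun_prop
  have hV : (fun t : ℝ => y + t • v) ⁻¹' U ∈ nhds (0 : ℝ) :=
    (hU.preimage hcont).mem_nhds (by simpa using hy)
  set g : ℝ → ℝ := fun t => φ (y + t • v) with hg
  have hd1 : ∀ᶠ t in nhds (0 : ℝ), HasDerivAt g (fderiv ℝ φ (y + t • v) v) t :=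
    Filter.eventually_of_mem hV fun t ht =>
      (differentiableAt_of_contDiffOn hU hφ ht).hasFDerivAt.comp_hasDerivAt t (hline t)
  have hd1' : deriv g =ᶠ[nhds 0] fun t => fderiv ℝ φ (y + t • v) v := hd1.mono fun t ht => ht.deriv
  have hd2 : deriv (deriv g) 0 = fderiv ℝ (fderiv ℝ φ) y v v := by
    rw [hd1'.deriv_eq]
    have h0 : HasFDerivAt (fderiv ℝ φ) (fderiv ℝ (fderiv ℝ φ) y) (y + (0 : ℝ) • v) := by
      rw [zero_smul, add_zero]
      exact (differentiableAt_of_contDiffOn hU (contDiffOn_fderiv hU hφ) hy).hasFDerivAt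
    have h1 : HasDerivAt (fun t : ℝ => fderiv ℝ φ (y + t • v)) (fderiv ℝ (fderiv ℝ φ) y v) 0 :=
      h0.comp_hasDerivAt (0 : ℝ) (hline 0)
    simpa using (h1.clm_apply (hasDerivAt_const (0 : ℝ) v)).deriv
  have hgmin : IsLocalMin g 0 := by
    have : Filter.Tendsto (fun t : ℝ => y + t • v) (nhds 0) (nhds y) := by
      simpa using hcont.tendsto 0
    refine (this.eventually hmin).mono fun t ht => ?_
    simpa [hg] using ht
  rw [← hd2]
  by_contra! hneg
  have hgmax : IsLocalMax g 0 := isLocalMax_of_deriv_deriv_neg hneg hgmin.deriv_eq_zero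
    hd1.self_of_nhds.continuousAt
  have hconst : g =ᶠ[nhds 0] fun _ => g 0 := by
    filter_upwards [hgmin, hgmax] with t h1 h2 using le_antisymm h2 h1
  have hd0 : deriv g =ᶠ[nhds 0] fun _ => 0 := by
    have := hconst.deriv
    simpa using this
  rw [hd0.deriv_eq] at hneg
  simp at hneg

theorem partialDeriv_eq_zero_of_isLocalMin (hmin : IsLocalMin φ y) (i : Fin n) :
    partialDeriv i φ y = 0 := by
  simp [partialDeriv, hmin.fderiv_eq_zero]

/-- Vector values are allowed because this also serves for the parametrization $X$. -/
theorem hessian_dotProduct (hU : IsOpen U) {V : Type*} [NormedAddCommGroup V] [NormedSpace ℝ V]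
    {ψ : EuclideanSpace ℝ (Fin n) → V} (hψ : ContDiffOn ℝ ∞ ψ U) (hy : y ∈ U) (v : Fin n → ℝ) :
    fderiv ℝ (fderiv ℝ ψ) y (WithLp.toLp 2 v) (WithLp.toLp 2 v) =
      ∑ i, ∑ j, (v i * v j) • partialDeriv i (partialDeriv j ψ) y := by
  have hv : WithLp.toLp 2 v = ∑ i, v i • EuclideanSpace.single i (1 : ℝ) := by
    simpa using ((EuclideanSpace.basisFun (Fin n) ℝ).sum_repr (WithLp.toLp 2 v)).symm
  rw [hv]
  simp only [map_sum, map_smul, sum_apply, smul_apply,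
    fderiv_fderiv_single hU hψ hy, Finset.smul_sum, smul_smul]
  rw [Finset.sum_comm]
  exact Finset.sum_congr rfl fun i _ => Finset.sum_congr rfl fun j _ => by rw [mul_comm]

theorem hessian_posSemidef_of_isLocalMin (hU : IsOpen U) (hφ : ContDiffOn ℝ ∞ φ U) (hy : y ∈ U)
    (hmin : IsLocalMin φ y) :
    (Matrix.of fun i j => partialDeriv i (partialDeriv j φ) y).PosSemidef := by
  refine Matrix.PosSemidef.of_dotProduct_mulVec_nonneg ?_ fun v => ?_
  · ext i j
    exact partialDeriv_comm hU hφ hy j i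
  · have := fderiv_fderiv_nonneg_of_isLocalMin hU hφ hy hmin (WithLp.toLp 2 v)
    rw [hessian_dotProduct hU hφ hy] at this
    refine this.trans_eq ?_
    simp only [dotProduct, Matrix.mulVec, Finset.mul_sum, Pi.star_apply, star_trivial,
      Matrix.of_apply, smul_eq_mul]
    exact Finset.sum_congr rfl fun i _ => Finset.sum_congr rfl fun j _ => by ring

end SecondDerivativeTest

/-! ### The exponential barrier -/

section Barrier

variable {n : ℕ} (α c : ℝ) (q : EuclideanSpace ℝ (Fin n))

/-- The barrier function of the Hopf lemma. -/
def hopfBarrier (x : EuclideanSpace ℝ (Fin n)) : ℝ := Real.exp (-α * ‖x - q‖ ^ 2) - c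

theorem contDiff_hopfBarrier : ContDiff ℝ ∞ (hopfBarrier α c q) :=
  ((contDiff_const.mul ((contDiff_id.sub contDiff_const).norm_sq ℝ)).exp).sub contDiff_const

/-- The constant `0` on the right leaves the bare exponential, which is positive everywhere. -/
theorem partialDeriv_hopfBarrier (l : Fin n) : partialDeriv l (hopfBarrier α c q) =
    fun x => (-2 * α * (x l - q l)) * hopfBarrier α 0 q x := by
  ext x
  have h := ((((hasFDerivAt_id (𝕜 := ℝ) x).sub_const q).norm_sq.const_mul (-α)).exp).sub_const c
  have h' : fderiv ℝ (hopfBarrier α c q) x = _ := h.fderiv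
  unfold partialDeriv
  rw [h']
  simp [hopfBarrier, EuclideanSpace.inner_single_right]
  ring

theorem partialDeriv_partialDeriv_hopfBarrier (i j : Fin n) (x : EuclideanSpace ℝ (Fin n)) :
    partialDeriv i (partialDeriv j (hopfBarrier α c q)) x =
      (4 * α ^ 2 * ((x i - q i) * (x j - q j)) - 2 * α * (if i = j then 1 else 0)) *
        hopfBarrier α 0 q x := by
  have hc : ContDiff ℝ ∞ fun x : EuclideanSpace ℝ (Fin n) => -2 * α * (x j - q j) := by fun_prop
  have hd : partialDeriv i (fun x : EuclideanSpace ℝ (Fin n) => -2 * α * (x j - q j)) x =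
      -2 * α * (if i = j then 1 else 0) := by
    have h := (((EuclideanSpace.proj j : EuclideanSpace ℝ (Fin n) →L[ℝ] ℝ).hasFDerivAt
      (x := x)).sub_const (q j)).const_mul (-2 * α)
    have h' : fderiv ℝ (fun x : EuclideanSpace ℝ (Fin n) => -2 * α * (x j - q j)) x = _ := h.fderiv
    unfold partialDeriv
    rw [h']
    rcases eq_or_ne i j with hij | hij
    · simp [hij]
    · simp [hij, hij.symm]
  rw [partialDeriv_hopfBarrier, partialDeriv_mul isOpen_univ hc.contDiffOn
    (contDiff_hopfBarrier α 0 q).contDiffOn (Set.mem_univ x), hd, partialDeriv_hopfBarrier]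
  ring

end Barrier

section StrongMinimumPrinciple

variable {n : ℕ} {U : Set (EuclideanSpace ℝ (Fin n))}
  {a : EuclideanSpace ℝ (Fin n) → Matrix (Fin n) (Fin n) ℝ}
  {b : EuclideanSpace ℝ (Fin n) → Fin n → ℝ} {w : EuclideanSpace ℝ (Fin n) → ℝ}

/-- The elliptic operator `a^{ij} ∂ᵢ∂ⱼ + b^l ∂_l`. -/
def ellipticOp (a : EuclideanSpace ℝ (Fin n) → Matrix (Fin n) (Fin n) ℝ)
    (b : EuclideanSpace ℝ (Fin n) → Fin n → ℝ) (w : EuclideanSpace ℝ (Fin n) → ℝ)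
    (x : EuclideanSpace ℝ (Fin n)) : ℝ :=
  ∑ i, ∑ j, a x i j * partialDeriv i (partialDeriv j w) x + ∑ l, b x l * partialDeriv l w x

theorem ellipticOp_add_const_mul (hU : IsOpen U) (hw : ContDiffOn ℝ ∞ w U)
    {v : EuclideanSpace ℝ (Fin n) → ℝ} (hv : ContDiffOn ℝ ∞ v U) (ε : ℝ)
    {x : EuclideanSpace ℝ (Fin n)} (hx : x ∈ U) :
    ellipticOp a b (fun x => w x + ε * v x) x = ellipticOp a b w x + ε * ellipticOp a b v x := by
  have h1 : ∀ (i : Fin n) {f g : EuclideanSpace ℝ (Fin n) → ℝ}, ContDiffOn ℝ ∞ f U →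
      ContDiffOn ℝ ∞ g U → ∀ y ∈ U, partialDeriv i (fun x => f x + ε * g x) y =
        partialDeriv i f y + ε * partialDeriv i g y := fun i f g hf hg y hy => by
    rw [partialDeriv_add hU hf (contDiffOn_const.mul hg) hy,
      partialDeriv_mul hU contDiffOn_const hg hy, partialDeriv_const]
    ring
  have h2 : ∀ i j, partialDeriv i (partialDeriv j fun x => w x + ε * v x) x =
      partialDeriv i (partialDeriv j w) x + ε * partialDeriv i (partialDeriv j v) x :=
    fun i j => by
      rw [partialDeriv_congr hU (h1 j hw hv) hx,
        h1 i (contDiffOn_partialDeriv hU hw j) (contDiffOn_partialDeriv hU hv j) x hx]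
  simp only [ellipticOp, h2, h1 _ hw hv x hx, mul_add, Finset.sum_add_distrib, Finset.mul_sum]
  simp only [mul_left_comm ε]
  ring

theorem ellipticOp_nonneg_of_isLocalMin (hU : IsOpen U) (hw : ContDiffOn ℝ ∞ w U)
    {x : EuclideanSpace ℝ (Fin n)} (hx : x ∈ U) (ha : (a x).PosSemidef) (hmin : IsLocalMin w x) :
    0 ≤ ellipticOp a b w x := by
  have := sum_mul_nonneg_of_posSemidef ha (hessian_posSemidef_of_isLocalMin hU hw hx hmin)
  simpa [ellipticOp, partialDeriv_eq_zero_of_isLocalMin hmin] using this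

theorem ellipticOp_hopfBarrier (α c : ℝ) (q x : EuclideanSpace ℝ (Fin n)) :
    ellipticOp a b (hopfBarrier α c q) x =
      (4 * α ^ 2 * ∑ i, ∑ j, a x i j * ((x i - q i) * (x j - q j)) -
        2 * α * (∑ i, a x i i + ∑ l, b x l * (x l - q l))) * hopfBarrier α 0 q x := by
  simp only [ellipticOp, partialDeriv_partialDeriv_hopfBarrier]
  simp only [partialDeriv_hopfBarrier]
  have h1 : ∀ i j, a x i j * ((4 * α ^ 2 * ((x i - q i) * (x j - q j)) -
      2 * α * (if i = j then 1 else 0)) * hopfBarrier α 0 q x) =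
      (4 * α ^ 2 * hopfBarrier α 0 q x) * (a x i j * ((x i - q i) * (x j - q j))) -
      (2 * α * hopfBarrier α 0 q x) * (if i = j then a x i j else 0) := by
    intro i j
    split_ifs <;> ring
  have h2 : ∀ l, b x l * (-2 * α * (x l - q l) * hopfBarrier α 0 q x) =
      (-2 * α * hopfBarrier α 0 q x) * (b x l * (x l - q l)) := fun l => by ring
  simp only [h1, h2, Finset.sum_sub_distrib, ← Finset.mul_sum, Finset.sum_ite_eq,
    Finset.mem_univ, if_true]
  ring

/-- Hopf's argument by contradiction. Were $w>0$ on the rest of the closed ball, subtracting a small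
multiple of a barrier $v$ with $Lv>0$ near $z$ would leave a function that is positive on a small
sphere about $z$ and zero at $z$. It would have an interior minimum, where $L$ of it is both
nonnegative and negative. -/
theorem exists_le_zero_of_touching_ball (hU : IsOpen U) (hw : ContDiffOn ℝ ∞ w U)
    (ha : ∀ x ∈ U, (a x).PosDef) (hac : ∀ i j, ContinuousOn (fun x => a x i j) U)
    (hbc : ∀ l, ContinuousOn (fun x => b x l) U) (hw0 : ∀ x ∈ U, 0 ≤ w x)
    (hL : ∀ x ∈ U, ellipticOp a b w x ≤ 0) {q z : EuclideanSpace ℝ (Fin n)} (hzq : z ≠ q)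
    (hz : z ∈ U) (hwz : w z = 0) :
    ∃ y ∈ U, dist y q ≤ dist z q ∧ y ≠ z ∧ w y ≤ 0 := by
  by_contra! hpos
  set r := dist z q
  set Q : EuclideanSpace ℝ (Fin n) → ℝ :=
    fun x => ∑ i, ∑ j, a x i j * ((x i - q i) * (x j - q j)) with hQ
  set T : EuclideanSpace ℝ (Fin n) → ℝ := fun x => ∑ i, a x i i + ∑ l, b x l * (x l - q l) with hT
  have hQz : 0 < Q z := by
    have hne : (fun i => z i - q i) ≠ 0 := by
      intro h0
      exact hzq (PiLp.ext fun i => sub_eq_zero.1 (congrFun h0 i))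
    have := (ha z hz).dotProduct_mulVec_pos hne
    simp only [dotProduct, Matrix.mulVec, Finset.mul_sum, Pi.star_apply, star_trivial] at this
    refine this.trans_eq ?_
    exact Finset.sum_congr rfl fun i _ => Finset.sum_congr rfl fun j _ => by ring
  -- Up to the positive exponential this is $Lv(z)$. For $\alpha=(|T|+1)/Q$ it equals
  -- $2\alpha(2(|T|+1)-T)$.
  obtain ⟨α, hα0, hα⟩ : ∃ α : ℝ, 0 < α ∧ 0 < 4 * α ^ 2 * Q z - 2 * α * T z := by
    have hpos' : 0 < (|T z| + 1) / Q z := by positivity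
    refine ⟨(|T z| + 1) / Q z, hpos', ?_⟩
    have e : (|T z| + 1) / Q z * Q z = |T z| + 1 := by field_simp
    have : 4 * ((|T z| + 1) / Q z) ^ 2 * Q z - 2 * ((|T z| + 1) / Q z) * T z =
      2 * ((|T z| + 1) / Q z) * (2 * ((|T z| + 1) / Q z * Q z) - T z) := by ring
    rw [this, e]
    refine mul_pos (by positivity) ?_
    linarith [le_abs_self (T z), abs_nonneg (T z)]
  have hKc : ContinuousOn (fun x => 4 * α ^ 2 * Q x - 2 * α * T x) U := by
    have hco : ∀ i, ContinuousOn (fun x : EuclideanSpace ℝ (Fin n) => x i - q i) U :=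
      fun i => by fun_prop
    refine (continuousOn_const.mul (continuousOn_finsetSum _ fun i _ =>
      continuousOn_finsetSum _ fun j _ => (hac i j).mul ((hco i).mul (hco j)))).sub
      (continuousOn_const.mul ((continuousOn_finsetSum _ fun i _ => hac i i).add
        (continuousOn_finsetSum _ fun l _ => (hbc l).mul (hco l))))
  have hev : ∀ᶠ x in nhds z, x ∈ U ∧ 0 < 4 * α ^ 2 * Q x - 2 * α * T x :=
    (hU.eventually_mem hz).and
      ((hKc.continuousAt (hU.mem_nhds hz)).eventually (lt_mem_nhds hα))
  obtain ⟨ρ, hρ, hball⟩ := Metric.nhds_basis_closedBall.eventually_iff.1 hev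
  -- Chosen so that the barrier vanishes on the sphere about `q` through `z` and is negative outside
  -- it.
  set c := Real.exp (-α * r ^ 2) with hc
  have hS : IsCompact (Metric.sphere z ρ ∩ Metric.closedBall q r) :=
    (isCompact_sphere z ρ).inter_right Metric.isClosed_closedBall
  have hsphere : ∀ y ∈ Metric.sphere z ρ, y ∈ U ∧ y ≠ z := fun y hy =>
    ⟨(hball (Metric.sphere_subset_closedBall hy)).1, fun h => by
      rw [h, Metric.mem_sphere, dist_self] at hy
      exact hρ.ne hy⟩
  obtain ⟨δ, hδ, hδw⟩ := hS.exists_forall_le' (a := 0)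
    (hw.continuousOn.mono fun y hy => (hsphere y hy.1).1)
    (fun y hy => hpos y (hsphere y hy.1).1 hy.2 (hsphere y hy.1).2)
  set v := hopfBarrier α c q with hv
  have hvs : ContDiffOn ℝ ∞ v U := (contDiff_hopfBarrier α c q).contDiffOn
  have hv1 : ∀ x, v x ≤ 1 := fun x => by
    have h1 : Real.exp (-α * ‖x - q‖ ^ 2) ≤ 1 := Real.exp_le_one_iff.2 (by
      have := mul_nonneg hα0.le (sq_nonneg ‖x - q‖)
      linarith)
    have h2 := Real.exp_pos (-α * r ^ 2)
    simp only [hv, hopfBarrier, hc]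
    linarith
  have hvout : ∀ x, r < dist x q → v x < 0 := fun x hx => by
    have h1 : r ^ 2 < ‖x - q‖ ^ 2 := by
      rw [← dist_eq_norm]
      exact pow_lt_pow_left₀ hx dist_nonneg two_ne_zero
    have : Real.exp (-α * ‖x - q‖ ^ 2) < Real.exp (-α * r ^ 2) := Real.exp_lt_exp.2 (by nlinarith)
    simp only [hv, hopfBarrier, hc]
    linarith
  have hvz : v z = 0 := by
    simp [hv, hopfBarrier, hc, ← dist_eq_norm, r]
  -- On the small sphere, $w\ge\delta$ and $v\le 1$ inside the ball about `q`, while $w\ge 0$ and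
  -- $v<0$ outside; either way $\varphi>0$.
  set φ : EuclideanSpace ℝ (Fin n) → ℝ := fun x => w x + (-(δ / 2)) * v x with hφ
  have hφs : ContDiffOn ℝ ∞ φ U := hw.add (contDiffOn_const.mul hvs)
  have hφsphere : ∀ y ∈ Metric.sphere z ρ, 0 < φ y := by
    intro y hy
    rcases le_or_gt (dist y q) r with h | h
    · have h1 := hδw y ⟨hy, h⟩
      have h2 := hv1 y
      simp only [hφ]
      nlinarith
    · have h1 := hw0 y (hsphere y hy).1
      have h2 := hvout y h
      simp only [hφ]
      nlinarith
  obtain ⟨y, hy, hymin⟩ := (isCompact_closedBall z ρ).exists_isMinOn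
    ⟨z, Metric.mem_closedBall_self hρ.le⟩ (hφs.continuousOn.mono fun x hx => (hball hx).1)
  have hφz : φ z = 0 := by simp [hφ, hwz, hvz]
  have hφy : φ y ≤ 0 := hφz ▸ hymin (Metric.mem_closedBall_self hρ.le)
  have hyb : y ∈ Metric.ball z ρ := by
    refine lt_of_le_of_ne (Metric.mem_closedBall.1 hy) fun h => ?_
    exact absurd (hφsphere y h) (not_lt.2 hφy)
  have hloc : IsLocalMin φ y :=
    hymin.isLocalMin (Filter.mem_of_superset (Metric.isOpen_ball.mem_nhds hyb)
      Metric.ball_subset_closedBall)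
  have hyU := (hball hy).1
  have h1 := ellipticOp_nonneg_of_isLocalMin (b := b) hU hφs hyU (ha y hyU).posSemidef hloc
  rw [hφ, ellipticOp_add_const_mul hU hw hvs _ hyU, hv, ellipticOp_hopfBarrier] at h1
  have h2 := hL y hyU
  have h3 : 0 < hopfBarrier α 0 q y := by simp [hopfBarrier, Real.exp_pos]
  have h4 := mul_pos (hball hy).2 h3
  simp only [hQ, hT] at h4
  nlinarith

/-- The strong minimum principle: a nonnegative supersolution that vanishes at a point vanishes
near that point. -/
theorem eventually_eq_zero_of_ellipticOp_nonpos (hU : IsOpen U) (hw : ContDiffOn ℝ ∞ w U)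
    (ha : ∀ x ∈ U, (a x).PosDef) (hac : ∀ i j, ContinuousOn (fun x => a x i j) U)
    (hbc : ∀ l, ContinuousOn (fun x => b x l) U) (hw0 : ∀ x ∈ U, 0 ≤ w x)
    (hL : ∀ x ∈ U, ellipticOp a b w x ≤ 0) {p : EuclideanSpace ℝ (Fin n)}
    (hp : p ∈ U) (hwp : w p = 0) : ∀ᶠ x in nhds p, w x = 0 := by
  obtain ⟨R, hR, hRU⟩ := Metric.nhds_basis_closedBall.mem_iff.1 (hU.mem_nhds hp)
  refine Filter.eventually_of_mem (Metric.ball_mem_nhds p (half_pos hR)) fun q hq => ?_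
  by_contra hwq
  have hqp : dist q p < R / 2 := hq
  set Z := Metric.closedBall p R ∩ w ⁻¹' {0} with hZ
  have hZc : IsCompact Z := by
    have hcl : IsClosed Z :=
      (hw.continuousOn.mono hRU).preimage_isClosed_of_isClosed Metric.isClosed_closedBall
        isClosed_singleton
    exact (isCompact_closedBall p R).of_isClosed_subset hcl Set.inter_subset_left
  have hpZ : p ∈ Z := ⟨Metric.mem_closedBall_self hR.le, hwp⟩
  obtain ⟨z, hzZ, hzmin⟩ := hZc.exists_isMinOn ⟨p, hpZ⟩
    (f := fun x => dist x q) (by fun_prop)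
  have hzq_le : dist z q ≤ dist p q := hzmin hpZ
  have hzq : z ≠ q := fun h => hwq (h ▸ hzZ.2)
  -- `z` is a zero nearest to `q`. The ball with diameter $zq$ meets the sphere about `q` through
  -- `z` only at `z`, so any other zero in it would be nearer to `q`.
  have hmid : midpoint ℝ z q ≠ z := by
    rwa [Ne, midpoint_eq_left_iff]
  obtain ⟨y, hyU, hyd, hyz, hwy⟩ := exists_le_zero_of_touching_ball hU hw ha hac hbc hw0 hL
    hmid.symm (hRU hzZ.1) hzZ.2
  have hd1 : dist z (midpoint ℝ z q) = dist z q / 2 := by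
    rw [dist_left_midpoint]; simp; ring
  have hd2 : dist (midpoint ℝ z q) q = dist z q / 2 := by
    rw [dist_midpoint_right]; simp; ring
  have hyq : dist y q < dist z q := by
    refine lt_of_le_of_ne ?_ fun h => ?_
    · linarith [dist_triangle y (midpoint ℝ z q) q]
    · have hym : dist y (midpoint ℝ z q) = dist z q / 2 :=
        le_antisymm (hyd.trans_eq hd1) (by linarith [dist_triangle y (midpoint ℝ z q) q])
      have := eq_midpoint_of_dist_eq_half (hym.trans (by rw [h])) (hd2.trans (by rw [h]))
      rw [midpoint_eq_midpoint_iff_vsub_eq_vsub] at this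
      simp only [vsub_eq_sub, sub_self, sub_eq_zero] at this
      exact hyz this.symm
  -- The radius $R/2$ for `q` is used here: `y` is at most as far from `q` as `p` is.
  have hyp : dist y p ≤ R := by
    rw [dist_comm p q] at hzq_le
    linarith [dist_triangle y q p]
  have hyZ : y ∈ Z := ⟨hyp, le_antisymm hwy (hw0 y hyU)⟩
  exact absurd (hzmin hyZ) (not_le.2 hyq)

end StrongMinimumPrinciple

/-! ### Local consequences for rotators and for convex minimal hypersurfaces -/

namespace IsLocalHypersurface

variable {n : ℕ} {U : Set (EuclideanSpace ℝ (Fin n))} {u : EuclideanSpace ℝ (Fin n)}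
  {X N : EuclideanSpace ℝ (Fin n) → EuclideanSpace ℝ (Fin (n + 1))}

theorem contDiffOn_dualFrame (h : IsLocalHypersurface U X N) (i : Fin n) :
    ContDiffOn ℝ ∞ (fun v => dualFrame X v i) U :=
  ContDiffOn.sum fun j _ => (h.contDiffOn_inv_metricMatrix i j).smul
    (contDiffOn_partialDeriv h.isOpen h.smooth j)

theorem contDiffOn_coordLaplacian (h : IsLocalHypersurface U X N) :
    ContDiffOn ℝ ∞ (coordLaplacian X) U :=
  ContDiffOn.sum fun i _ => ContDiffOn.sum fun j _ => (h.contDiffOn_inv_metricMatrix i j).smul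
    (contDiffOn_partialDeriv h.isOpen (contDiffOn_partialDeriv h.isOpen h.smooth j) i)

theorem sum_inner_normal_deriv_nonneg (h : IsLocalHypersurface U X N) (hu : u ∈ U) :
    0 ≤ ∑ i, ∑ j, (metricMatrix X u)⁻¹ i j *
      inner ℝ (partialDeriv i N u) (partialDeriv j N u) :=
  sum_mul_nonneg_of_posSemidef (h.inv_metricMatrix_posDef hu).posSemidef
    (Matrix.posSemidef_gram ℝ fun i => partialDeriv i N u)

/-- On a mean convex rotator the zero set of the mean curvature is open. -/
theorem eventually_inner_rotation_eq_zero (h : IsLocalHypersurface U X N)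
    (J : EuclideanSpace ℝ (Fin (n + 1)) →L[ℝ] EuclideanSpace ℝ (Fin (n + 1)))
    (hJ : ∀ y z, inner ℝ (J y) z = -inner ℝ y (J z))
    (hH : ∀ v ∈ U, inner ℝ (meanCurvatureVector X v) (N v) = inner ℝ (J (X v)) (N v))
    (hle : ∀ v ∈ U, inner ℝ (J (X v)) (N v) ≤ 0) (hu : u ∈ U)
    (h0 : inner ℝ (J (X u)) (N u) = 0) : ∀ᶠ v in nhds u, inner ℝ (J (X v)) (N v) = 0 := by
  have hH' : ∀ v ∈ U, ∑ i, ∑ j, (metricMatrix X v)⁻¹ i j *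
      inner ℝ (partialDeriv i (partialDeriv j X) v) (N v) = inner ℝ (J (X v)) (N v) :=
    fun v hv => by rw [← h.inner_meanCurvatureVector hv, hH v hv]
  have hJX : ContDiffOn ℝ ∞ (fun v => J (X v)) U := J.contDiff.comp_contDiffOn h.smooth
  set f : EuclideanSpace ℝ (Fin n) → ℝ := fun v => inner ℝ (J (X v)) (N v) with hf
  have hfs : ContDiffOn ℝ ∞ f U := hJX.inner ℝ h.smooth_normal
  -- The first order terms of the Jacobi equation, moved to the left; what remains is $-|A|^2f\ge
  -- 0$.
  set b : EuclideanSpace ℝ (Fin n) → Fin n → ℝ := fun v l =>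
    -inner ℝ (coordLaplacian X v - J (X v)) (dualFrame X v l) with hb
  have hbc : ∀ l, ContinuousOn (fun v => b v l) U := fun l =>
    (((h.contDiffOn_coordLaplacian.sub hJX).inner ℝ (h.contDiffOn_dualFrame l)).neg).continuousOn
  have hLf : ∀ v ∈ U, 0 ≤ ellipticOp (fun v => (metricMatrix X v)⁻¹) b f v := by
    intro v hv
    have h1 := h.jacobi_equation hv J hJ hH'
    have h2 := mul_nonpos_of_nonneg_of_nonpos (h.sum_inner_normal_deriv_nonneg hv) (hle v hv)
    simp only [ellipticOp, hb, neg_mul, Finset.sum_neg_distrib]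
    rw [h1]
    linarith
  have hev := eventually_eq_zero_of_ellipticOp_nonpos (w := fun v => 0 + (-1) * f v)
    h.isOpen (contDiffOn_const.add (contDiffOn_const.mul hfs))
    (fun v hv => h.inv_metricMatrix_posDef hv)
    (fun i j => (h.contDiffOn_inv_metricMatrix i j).continuousOn) hbc
    (fun v hv => by have := hle v hv; simp only [hf]; linarith)
    (fun v hv => by
      have h1 := hLf v hv
      rw [ellipticOp_add_const_mul h.isOpen contDiffOn_const hfs _ hv]
      have h3 : ellipticOp (fun v => (metricMatrix X v)⁻¹) b (fun _ => (0 : ℝ)) v = 0 := by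
        have h4 : ∀ j : Fin n, partialDeriv j (fun _ : EuclideanSpace ℝ (Fin n) => (0 : ℝ)) =
          fun _ => 0 := fun j => funext fun _ => by simp [partialDeriv]
        simp [ellipticOp, h4]
      rw [h3]
      linarith) hu (by simp [hf, h0])
  refine hev.mono fun v hv => ?_
  simpa using hv

/-- At a local minimum of the distance to the origin a rotation field is tangential. -/
theorem inner_rotation_eq_zero_of_isLocalMin (h : IsLocalHypersurface U X N)
    (J : EuclideanSpace ℝ (Fin (n + 1)) →L[ℝ] EuclideanSpace ℝ (Fin (n + 1)))
    (hJ : ∀ y z, inner ℝ (J y) z = -inner ℝ y (J z)) (hu : u ∈ U)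
    (hmin : IsLocalMin (fun v => ‖X v‖ ^ 2) u) : inner ℝ (J (X u)) (N u) = 0 := by
  have hd := (differentiableAt_of_contDiffOn h.isOpen h.smooth hu).hasFDerivAt.norm_sq
  have hz := hmin.hasFDerivAt_eq_zero hd
  -- Criticality of $|X|^2$ says exactly that $X\perp\partial_iX$ for all $i$.
  have horth : X u ∈ (tangentPlane X u)ᗮ := by
    rw [Submodule.mem_orthogonal]
    rintro _ ⟨v, rfl⟩
    have := congrArg (fun L : EuclideanSpace ℝ (Fin n) →L[ℝ] ℝ => L v) hz
    rw [real_inner_comm]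
    simpa using this
  rw [h.eq_smul_normal hu horth, map_smul, inner_smul_left]
  have := hJ (N u) (N u)
  have := real_inner_comm (J (N u)) (N u)
  have : inner ℝ (J (N u)) (N u) = 0 := by linarith
  simp [this]

theorem inner_secondFundamentalForm (h : IsLocalHypersurface U X N) (hu : u ∈ U)
    (v w : EuclideanSpace ℝ (Fin n)) :
    inner ℝ (secondFundamentalForm X u v w) (N u) =
      inner ℝ (fderiv ℝ (fderiv ℝ X) u v w) (N u) := by
  unfold secondFundamentalForm
  rw [h.normalPart_eq hu, inner_smul_left, h.inner_normal_normal hu]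
  simp

/-- The normal field of a convex minimal hypersurface is parallel. -/
theorem fderiv_normal_eq_zero (h : IsLocalHypersurface U X N) (hu : u ∈ U)
    (hmin : meanCurvatureVector X u = 0)
    (hconv : ∀ v, 0 ≤ -inner ℝ (secondFundamentalForm X u v v) (N u)) :
    fderiv ℝ N u = 0 := by
  set B : Matrix (Fin n) (Fin n) ℝ := Matrix.of fun i j =>
    -inner ℝ (partialDeriv i (partialDeriv j X) u) (N u) with hB
  have hpos : B.PosSemidef := by
    refine Matrix.PosSemidef.of_dotProduct_mulVec_nonneg ?_ fun v => ?_
    · ext i j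
      simp only [hB, Matrix.conjTranspose_apply, Matrix.of_apply, star_trivial]
      rw [partialDeriv_comm h.isOpen h.smooth hu]
    · have := hconv (WithLp.toLp 2 v)
      rw [h.inner_secondFundamentalForm hu, hessian_dotProduct h.isOpen h.smooth hu] at this
      refine this.trans_eq ?_
      simp only [dotProduct, Matrix.mulVec, Finset.mul_sum, Pi.star_apply, star_trivial, hB,
        Matrix.of_apply, sum_inner, inner_smul_left, RCLike.conj_to_real,
        ← Finset.sum_neg_distrib]
      exact Finset.sum_congr rfl fun i _ => Finset.sum_congr rfl fun j _ => by ring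
  have htr := h.inner_meanCurvatureVector hu
  rw [hmin, inner_zero_left] at htr
  -- `B` is $h$ in coordinates: positive semidefinite, with zero trace against $g^{-1}$.
  have hB0 : B = 0 := by
    refine eq_zero_of_sum_mul_eq_zero (h.inv_metricMatrix_posDef hu) hpos ?_
    simp only [hB, Matrix.of_apply, mul_neg, Finset.sum_neg_distrib, ← htr, neg_zero]
  have hN : ∀ i, partialDeriv i N u = 0 := fun i => by
    rw [h.normal_deriv_eq_sum_dualFrame hu]
    refine Finset.sum_eq_zero fun j _ => ?_
    have h1 : -inner ℝ (partialDeriv i (partialDeriv j X) u) (N u) = 0 :=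
      congrFun (congrFun hB0 i) j
    rw [h.inner_partialDeriv_partialDeriv_normal hu, neg_neg] at h1
    rw [real_inner_comm, h1, zero_smul]
  ext1 v
  change fderiv ℝ N u v = 0
  have hv : v = ∑ i, v i • EuclideanSpace.single i (1 : ℝ) := by
    simpa using ((EuclideanSpace.basisFun (Fin n) ℝ).sum_repr v).symm
  rw [hv]
  simp only [map_sum, map_smul]
  refine Finset.sum_eq_zero fun i _ => ?_
  have := hN i
  unfold partialDeriv at this
  rw [this]; simp

end IsLocalHypersurface

/-- Properness makes $|x|$ tend to infinity along the cocompact filter of $M$, so its infimum is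
attained. -/
theorem exists_forall_norm_le {n : ℕ} {M : Type*} [TopologicalSpace M] [Nonempty M]
    {x : M → EuclideanSpace ℝ (Fin (n + 1))} (hx : IsProperMap x) : ∃ p, ∀ q, ‖x p‖ ≤ ‖x q‖ :=
  hx.continuous.norm.exists_forall_le
    ((tendsto_norm_cocompact_atTop (E := EuclideanSpace ℝ (Fin (n + 1)))).comp
      (isProperMap_iff_tendsto_cocompact.1 hx).2)

/-! ### From charts to the manifold: minimality of the rotator -/

section Manifold

variable {n : ℕ} {M : Type*} [TopologicalSpace M] [ChartedSpace (EuclideanSpace ℝ (Fin n)) M]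

section Charts

variable {V : Type*} [NormedAddCommGroup V] [NormedSpace ℝ V]

theorem contDiffOn_comp_chart_symm [IsManifold (𝓡 n) ∞ M] {g : M → V}
    (hg : ContMDiff (𝓡 n) 𝓘(ℝ, V) ∞ g)
    {e : OpenPartialHomeomorph M (EuclideanSpace ℝ (Fin n))}
    (he : e ∈ atlas (EuclideanSpace ℝ (Fin n)) M) : ContDiffOn ℝ ∞ (g ∘ e.symm) e.target :=
  contMDiffOn_iff_contDiffOn.1 (hg.comp_contMDiffOn
    (contMDiffOn_symm_of_mem_maximalAtlas (IsManifold.subset_maximalAtlas he)))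

/-- A smooth function on a connected manifold whose derivative vanishes in all charts is
constant. -/
theorem eq_of_fderiv_comp_chart_symm_eq_zero [PreconnectedSpace M] [IsManifold (𝓡 n) ∞ M]
    {g : M → V} (hg : ContMDiff (𝓡 n) 𝓘(ℝ, V) ∞ g)
    (hg' : ∀ e ∈ atlas (EuclideanSpace ℝ (Fin n)) M, ∀ u ∈ e.target,
      fderiv ℝ (g ∘ e.symm) u = 0) (p q : M) : g p = g q := by
  have hloc : IsLocallyConstant g := by
    rw [IsLocallyConstant.iff_eventually_eq]
    intro p
    set e := chartAt (EuclideanSpace ℝ (Fin n)) p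
    have he : e ∈ atlas (EuclideanSpace ℝ (Fin n)) M := chart_mem_atlas _ p
    have hp : p ∈ e.source := mem_chart_source _ p
    have hopen := e.open_target.isOpen_inter_preimage_of_fderiv_eq_zero (𝕜 := ℝ)
      ((contDiffOn_comp_chart_symm hg he).differentiableOn (by simp)) (hg' e he) {g p}
    have hmem : e p ∈ e.target ∩ (g ∘ e.symm) ⁻¹' {g p} :=
      ⟨e.map_source hp, by simp [e.left_inv hp]⟩
    filter_upwards [(e.continuousAt hp).eventually (hopen.mem_nhds hmem),
      e.open_source.mem_nhds hp] with q hq hqs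
    simpa [e.left_inv hqs] using hq.2
  exact hloc.apply_eq_of_preconnectedSpace p q

end Charts

variable {x ν : M → EuclideanSpace ℝ (Fin (n + 1))}

theorem isLocalHypersurface_chart [IsManifold (𝓡 n) ∞ M] (hx : IsProperImmersion x)
    (hν : IsUnitNormalField x ν) {e : OpenPartialHomeomorph M (EuclideanSpace ℝ (Fin n))}
    (he : e ∈ atlas (EuclideanSpace ℝ (Fin n)) M) :
    IsLocalHypersurface e.target (x ∘ e.symm) (ν ∘ e.symm) where
  isOpen := e.open_target
  smooth := contDiffOn_comp_chart_symm hx.smooth he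
  smooth_normal := contDiffOn_comp_chart_symm hν.smooth he
  injective u hu := by
    have : IsManifold (𝓡 n) 1 M := IsManifold.of_le (n := ∞) (by simp)
    have hs := (mdifferentiable_of_mem_atlas (I := 𝓡 n) he).symm
    have h1 := mfderiv_comp (I := 𝓡 n) (I' := 𝓡 n)
      (I'' := 𝓘(ℝ, EuclideanSpace ℝ (Fin (n + 1)))) u
      (hx.smooth.mdifferentiable (by simp) (e.symm u)) (hs.mdifferentiableAt hu)
    rw [← mfderiv_eq_fderiv, h1]
    exact (hx.immersion (e.symm u)).comp (hs.mfderiv_injective hu)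
  norm_normal u _ := hν.norm_eq_one _
  normal u hu := by
    have := hν.normal e he (e.symm u) (e.map_target hu)
    rwa [e.right_inv hu] at this

theorem inner_toEuclideanLin_of_mem_so {J : Matrix (Fin (n + 1)) (Fin (n + 1)) ℝ}
    (hJ : J ∈ LieAlgebra.Orthogonal.so (Fin (n + 1)) ℝ) (y z : EuclideanSpace ℝ (Fin (n + 1))) :
    inner ℝ (Matrix.toEuclideanLin J y) z = -inner ℝ y (Matrix.toEuclideanLin J z) := by
  rw [LieAlgebra.Orthogonal.mem_so] at hJ
  rw [← LinearMap.adjoint_inner_right, ← Matrix.toEuclideanLin_conjTranspose_eq_adjoint,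
    Matrix.conjTranspose_eq_transpose_of_trivial, hJ, map_neg, LinearMap.neg_apply, inner_neg_right]

/-- A proper weakly mean convex rotator is minimal. -/
theorem isMinimalHypersurface_of_isRotator [ConnectedSpace M] [IsManifold (𝓡 n) ∞ M]
    (hx : IsProperImmersion x) (hrot : IsRotator x) (hmc : IsWeaklyMeanConvex x) :
    IsMinimalHypersurface x := by
  obtain ⟨A, hA, hrotA⟩ := hrot
  obtain ⟨ν, hν, hH⟩ := hmc
  set J : EuclideanSpace ℝ (Fin (n + 1)) →L[ℝ] EuclideanSpace ℝ (Fin (n + 1)) :=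
    (Matrix.toEuclideanLin A).toContinuousLinearMap
  have hJ : ∀ y z, inner ℝ (J y) z = -inner ℝ y (J z) := inner_toEuclideanLin_of_mem_so hA
  have hloc := fun (e : OpenPartialHomeomorph M (EuclideanSpace ℝ (Fin n)))
    (he : e ∈ atlas (EuclideanSpace ℝ (Fin n)) M) => isLocalHypersurface_chart hx hν he
  have hmcv : ∀ e ∈ atlas (EuclideanSpace ℝ (Fin n)) M, ∀ p ∈ e.source,
      meanCurvatureVector (x ∘ e.symm) (e p) = inner ℝ (J (x p)) (ν p) • ν p := by
    intro e he p hp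
    rw [hrotA e he p hp, (hloc e he).normalPart_eq (e.map_source hp)]
    simp only [Function.comp_apply, e.left_inv hp]
    rfl
  have hinner : ∀ e ∈ atlas (EuclideanSpace ℝ (Fin n)) M, ∀ p ∈ e.source,
      inner ℝ (meanCurvatureVector (x ∘ e.symm) (e p)) (ν p) = inner ℝ (J (x p)) (ν p) := by
    intro e he p hp
    rw [hmcv e he p hp, inner_smul_left, real_inner_self_eq_norm_sq, hν.norm_eq_one]
    simp
  have hle : ∀ p, inner ℝ (J (x p)) (ν p) ≤ 0 := by
    intro p
    have h1 := hH _ (chart_mem_atlas _ p) p (mem_chart_source (EuclideanSpace ℝ (Fin n)) p)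
    rw [hinner _ (chart_mem_atlas _ p) p (mem_chart_source (EuclideanSpace ℝ (Fin n)) p)] at h1
    linarith
  set Z : Set M := {p | inner ℝ (J (x p)) (ν p) = 0} with hZ
  have hmem : ∀ p, p ∈ Z ↔ inner ℝ (J (x p)) (ν p) = 0 := fun _ => Iff.rfl
  have hclosed : IsClosed Z :=
    isClosed_eq ((J.continuous.comp hx.smooth.continuous).inner hν.smooth.continuous)
      continuous_const
  have hopen : IsOpen Z := by
    rw [isOpen_iff_mem_nhds]
    intro p hp
    set e := chartAt (EuclideanSpace ℝ (Fin n)) p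
    have he : e ∈ atlas (EuclideanSpace ℝ (Fin n)) M := chart_mem_atlas _ p
    have hps : p ∈ e.source := mem_chart_source _ p
    have hev := (hloc e he).eventually_inner_rotation_eq_zero J hJ
      (fun v hv => by
        have := hinner e he (e.symm v) (e.map_target hv)
        rwa [e.right_inv hv] at this)
      (fun v _ => hle (e.symm v)) (e.map_source hps)
      (by simpa [e.left_inv hps, hmem] using hp)
    filter_upwards [(e.continuousAt hps).eventually hev, e.open_source.mem_nhds hps] with q hq hqs
    simpa [e.left_inv hqs, hmem] using hq
  -- A point of $M$ whose image is closest to the origin, the centre of the rotation.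
  have hne : Z.Nonempty := by
    obtain ⟨p, hp⟩ := exists_forall_norm_le hx.proper
    set e := chartAt (EuclideanSpace ℝ (Fin n)) p
    have hps : p ∈ e.source := mem_chart_source _ p
    have h0 := (hloc e (chart_mem_atlas _ p)).inner_rotation_eq_zero_of_isLocalMin J hJ
      (e.map_source hps) (Filter.Eventually.of_forall fun v => by
        simp only [Function.comp_apply, e.left_inv hps]
        exact pow_le_pow_left₀ (norm_nonneg _) (hp _) 2)
    exact ⟨p, by simpa [e.left_inv hps, hmem] using h0⟩
  have huniv : Z = Set.univ := IsClopen.eq_univ ⟨hclosed, hopen⟩ hne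
  intro e he p hp
  have h0 : inner ℝ (J (x p)) (ν p) = 0 := (hmem p).1 (huniv.symm ▸ Set.mem_univ p)
  rw [hmcv e he p hp, h0, zero_smul]

end Manifold

/-! ### Covering spaces and the hyperplane case -/

/-- A proper local homeomorphism from a connected Hausdorff space to a simply connected, locally
path connected space is bijective. -/
theorem bijective_of_isProperMap_of_isLocalHomeomorph {M W : Type*} [TopologicalSpace M]
    [T2Space M] [ConnectedSpace M] [TopologicalSpace W] [SimplyConnectedSpace W]
    [LocallyPathConnectedSpace W] {φ : M → W} (hp : IsProperMap φ) (hl : IsLocalHomeomorph φ) :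
    Function.Bijective φ := by
  -- Fibres are compact by properness and discrete because `φ` is a local homeomorphism.
  have hfin : ∀ w, (φ ⁻¹' {w}).Finite := fun w =>
    (hp.isCompact_preimage isCompact_singleton).finite
      (IsDiscrete.of_openPartialHomeomorph φ subset_rfl fun p _ => by
        obtain ⟨ψ, h1, h2⟩ := hl p
        exact ⟨ψ, h1, h2.symm⟩)
  have hcov : IsCoveringMap φ := isCoveringMap_iff_isCoveringMapOn_univ.2
    (hp.isClosedMap.isCoveringMapOn_of_isLocalHomeomorphOn (fun w _ => hfin w)
      (hl.isLocalHomeomorphOn))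
  obtain ⟨p₀⟩ := (inferInstance : Nonempty M)
  obtain ⟨F, ⟨hF0, hF⟩, -⟩ :=
    hcov.existsUnique_continuousMap_lifts (ContinuousMap.id W) (φ p₀) p₀ rfl
  -- `F` is a global section through `p₀`. Both `F ∘ φ` and the identity lift `φ` and agree at `p₀`,
  -- so they coincide on the connected space `M`.
  have hinv : F ∘ φ = id := hcov.eq_of_comp_eq (F.continuous.comp hp.continuous) continuous_id
    (by rw [← Function.comp_assoc, hF]; rfl) p₀ hF0
  exact ⟨Function.LeftInverse.injective (congrFun hinv),
    Function.RightInverse.surjective (congrFun hF)⟩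

section Manifold

variable {n : ℕ} {M : Type*} [TopologicalSpace M] [ChartedSpace (EuclideanSpace ℝ (Fin n)) M]
  {x ν : M → EuclideanSpace ℝ (Fin (n + 1))}

/-- The orthogonal projection of a hypersurface with constant normal field to the orthogonal
complement of the normal is a local homeomorphism. -/
theorem isLocalHomeomorph_orthogonalProjection [IsManifold (𝓡 n) ∞ M] (hx : IsProperImmersion x)
    (hν : IsUnitNormalField x ν) {ν₀ : EuclideanSpace ℝ (Fin (n + 1))} (hν₀ : ∀ p, ν p = ν₀)
    (hne : ν₀ ≠ 0) :
    IsLocalHomeomorph fun p => (ℝ ∙ ν₀)ᗮ.orthogonalProjectionOnto (x p) := by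
  refine IsLocalHomeomorph.mk _ fun p => ?_
  set P := (ℝ ∙ ν₀)ᗮ.orthogonalProjectionOnto
  set e := chartAt (EuclideanSpace ℝ (Fin n)) p
  have hp : p ∈ e.source := mem_chart_source _ p
  have h := isLocalHypersurface_chart hx hν (chart_mem_atlas (EuclideanSpace ℝ (Fin n)) p)
  set X := x ∘ e.symm
  have hu : e p ∈ e.target := e.map_source hp
  set L : EuclideanSpace ℝ (Fin n) →L[ℝ] (ℝ ∙ ν₀)ᗮ := P ∘L fderiv ℝ X (e p)
  -- A tangent vector killed by the projection is a multiple of `ν₀`, yet it is also orthogonal to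
  -- `ν₀`.
  have hLinj : Function.Injective L := by
    rw [injective_iff_map_eq_zero]
    intro v hv
    have h1 : fderiv ℝ X (e p) v ∈ (ℝ ∙ ν₀)ᗮᗮ :=
      Submodule.orthogonalProjectionOnto_eq_zero_iff.1 hv
    have h2 : fderiv ℝ X (e p) v ∈ (ℝ ∙ ν₀)ᗮ := by
      rw [Submodule.mem_orthogonal_singleton_iff_inner_left]
      have := h.inner_fderiv_normal hu v
      simpa [hν₀] using this
    have h3 : fderiv ℝ X (e p) v = 0 :=
      inner_self_eq_zero.1 ((Submodule.mem_orthogonal _ _).1 h1 _ h2)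
    exact h.injective _ hu (h3.trans (map_zero _).symm)
  have : Fact (Module.finrank ℝ (EuclideanSpace ℝ (Fin (n + 1))) = n + 1) := ⟨by simp⟩
  have hfr : Module.finrank ℝ (EuclideanSpace ℝ (Fin n)) = Module.finrank ℝ (ℝ ∙ ν₀)ᗮ := by
    rw [Submodule.finrank_orthogonal_span_singleton (n := n) hne, finrank_euclideanSpace_fin]
  set L' : EuclideanSpace ℝ (Fin n) ≃L[ℝ] (ℝ ∙ ν₀)ᗮ :=
    (LinearMap.linearEquivOfInjective L.toLinearMap hLinj hfr).toContinuousLinearEquiv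
  have hψ : ContDiffAt ℝ ∞ (fun v => P (X v)) (e p) :=
    P.contDiff.contDiffAt.comp _ (h.smooth.contDiffAt (h.isOpen.mem_nhds hu))
  have hψ' : HasFDerivAt (fun v => P (X v))
      (L' : EuclideanSpace ℝ (Fin n) →L[ℝ] (ℝ ∙ ν₀)ᗮ) (e p) := by
    have h1 : (L' : EuclideanSpace ℝ (Fin n) →L[ℝ] (ℝ ∙ ν₀)ᗮ) = L := by
      ext1 v; rfl
    rw [h1]
    exact P.hasFDerivAt.comp _
      (differentiableAt_of_contDiffOn h.isOpen h.smooth hu).hasFDerivAt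
  set ψ := hψ.toOpenPartialHomeomorph _ hψ' (by simp)
  refine ⟨e.trans ψ, ⟨hp, hψ.mem_toOpenPartialHomeomorph_source hψ' (by simp)⟩, fun q hq => ?_⟩
  have hq' : q ∈ e.source := hq.1
  change P (x q) = P (X (e q))
  simp only [X, Function.comp_apply, e.left_inv hq']

/-- A proper immersed hypersurface which is minimal and weakly convex is a hyperplane. -/
theorem isHyperplane_of_isMinimalHypersurface [T2Space M] [ConnectedSpace M]
    [IsManifold (𝓡 n) ∞ M] (hx : IsProperImmersion x) (hmin : IsMinimalHypersurface x)
    (hconv : IsWeaklyConvex x) : IsHyperplane x := by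
  obtain ⟨ν, hν, hh⟩ := hconv
  obtain ⟨p₀⟩ := (inferInstance : Nonempty M)
  set ν₀ := ν p₀
  have hν₀ : ∀ p, ν p = ν₀ := fun p =>
    eq_of_fderiv_comp_chart_symm_eq_zero hν.smooth (fun e he u hu => by
      refine (isLocalHypersurface_chart hx hν he).fderiv_normal_eq_zero hu ?_ fun v => ?_
      · have := hmin e he (e.symm u) (e.map_target hu)
        rwa [e.right_inv hu] at this
      · have := hh e he (e.symm u) (e.map_target hu) v
        rwa [e.right_inv hu] at this) p p₀
  have hnorm : ‖ν₀‖ = 1 := hν.norm_eq_one p₀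
  have hne : ν₀ ≠ 0 := fun h => by simp [h] at hnorm
  set c := inner ℝ ν₀ (x p₀)
  -- The height in direction `ν₀` has zero derivative, since `ν₀` is normal everywhere.
  have hc : ∀ p, inner ℝ ν₀ (x p) = c := fun p => by
    have hg : ContMDiff (𝓡 n) 𝓘(ℝ, ℝ) ∞ fun p => innerSL ℝ ν₀ (x p) :=
      (innerSL ℝ ν₀).contMDiff.comp hx.smooth
    refine eq_of_fderiv_comp_chart_symm_eq_zero hg (fun e he u hu => ?_) p p₀
    have h := isLocalHypersurface_chart hx hν he
    have h1 := ((innerSL ℝ ν₀).hasFDerivAt.comp u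
      (differentiableAt_of_contDiffOn h.isOpen h.smooth hu).hasFDerivAt).fderiv
    refine h1.trans ?_
    ext1 v
    have := h.inner_fderiv_normal hu v
    rw [real_inner_comm] at this
    simpa [hν₀] using this
  set W := (ℝ ∙ ν₀)ᗮ
  set φ : M → W := fun p => W.orthogonalProjectionOnto (x p)
  have hφx : ∀ p, x p = φ p + c • ν₀ := fun p => by
    have h1 := (ℝ ∙ ν₀).starProjection_add_starProjection_orthogonal (x p)
    rw [Submodule.starProjection_unit_singleton ℝ hnorm, hc p] at h1
    exact h1.symm.trans (add_comm _ _)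
  -- `x` is `φ` followed by an injective continuous translation, so properness passes from `x` to
  -- `φ`.
  have hprop : IsProperMap φ := by
    refine isProperMap_of_comp_of_inj (g := fun w : W => (w : EuclideanSpace ℝ (Fin (n + 1))) +
      c • ν₀) (W.orthogonalProjectionOnto.continuous.comp hx.smooth.continuous)
      (by fun_prop) ?_ fun a b hab => Subtype.ext (add_right_cancel hab)
    convert hx.proper using 1
    exact funext fun p => (hφx p).symm
  have hbij := bijective_of_isProperMap_of_isLocalHomeomorph hprop
    (isLocalHomeomorph_orthogonalProjection hx hν hν₀ hne)
  have hinj : Function.Injective x := fun p q hpq => hbij.1 (by simp only [φ, hpq])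
  refine ⟨(Topology.IsClosedEmbedding.of_continuous_injective_isClosedMap
    hx.smooth.continuous hinj hx.proper.isClosedMap).isEmbedding,
    AffineSubspace.mk' (c • ν₀) W, ?_, ?_⟩
  · have : Fact (Module.finrank ℝ (EuclideanSpace ℝ (Fin (n + 1))) = n + 1) := ⟨by simp⟩
    rw [AffineSubspace.direction_mk', Submodule.finrank_orthogonal_span_singleton (n := n) hne]
  · ext y
    rw [SetLike.mem_coe, AffineSubspace.mem_mk', vsub_eq_sub]
    constructor
    · rintro ⟨p, rfl⟩
      rw [hφx p, add_sub_cancel_right]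
      exact (φ p).2
    · intro hy
      obtain ⟨p, hp⟩ := hbij.2 ⟨_, hy⟩
      exact ⟨p, by rw [hφx p, hp]; simp⟩

end Manifold

end Rotator

end

theorem theorem1p7 {n : ℕ} {M : Type*} [TopologicalSpace M] [T2Space M]
    [SecondCountableTopology M] [ConnectedSpace M]
    [ChartedSpace (EuclideanSpace ℝ (Fin n)) M] [IsManifold (𝓡 n) ∞ M]
    (x₀ : M → EuclideanSpace ℝ (Fin (n + 1)))
    (himm : Rotator.IsProperImmersion x₀) (hrot : Rotator.IsRotator x₀)
    (hH : Rotator.IsWeaklyMeanConvex x₀) :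
    Rotator.IsMinimalHypersurface x₀ ∧
      (Rotator.IsWeaklyConvex x₀ → Rotator.IsHyperplane x₀) :=
  have hmin := Rotator.isMinimalHypersurface_of_isRotator himm hrot hH
  ⟨hmin, Rotator.isHyperplane_of_isMinimalHypersurface himm hmin⟩
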